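/- Let $H$ be a complex Hilbert space with $\dim H \ge 3$ (possibly infinite-dimensional), let $P(H)$ be the set of all one-dimensional subspaces (lines) $[v] = \mathbb{C}v$, $0 \ne v \in H$, and for unit vectors $u, v \in H$ let $\measuredangle([u],[v]) := \arccos|\langle u,v\rangle| \in [0,\pi/2]$ denote the quantum angle. Fix a number $\alpha$ with $\frac{\pi}{4} < \alpha < \frac{\pi}{2}$. Let $\phi\colon P(H)\to P(H)$ be a bijective map which preserves the quantum angle $\alpha$ in both directions, that is, for all $[u],[v]\in P(H)$, $$\measuredangle([u],[v]) = \alpha \iff \measuredangle(\phi([u]),\phi([v])) = \alpha .$$ Then $\phi$ is a Wigner symmetry, that is, there exists a unitary operator or an antiunitary operator (a bijective conjugate-linear isometry) $U\colon H\to H$ such that $\phi([v]) = [Uv]$ for all $[v]\in P(H)$. -/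

import Mathlib

open scoped LinearAlgebra.Projectivization

section QuantumAngle

variable {H : Type*} [NormedAddCommGroup H] [InnerProductSpace ℂ H]

/-- The quantum angle (Fubini-Study distance) between two lines of `H`: the arccosine of
`|⟪u, v⟫| / (‖u‖ ‖v‖)`, where `u`, `v` are arbitrary nonzero vectors spanning the two lines
(see `quantumAngle_mk` for the independence of the choice). -/
noncomputable def quantumAngle (p q : ℙ ℂ H) : ℝ :=
  Real.arccos (‖inner ℂ p.rep q.rep‖ / (‖p.rep‖ * ‖q.rep‖))

theorem quantumAngle_mk (u v : H) (hu : u ≠ 0) (hv : v ≠ 0) :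
    quantumAngle (Projectivization.mk ℂ u hu) (Projectivization.mk ℂ v hv) =
      Real.arccos (‖inner ℂ u v‖ / (‖u‖ * ‖v‖)) := by
  obtain ⟨a, ha⟩ := Projectivization.exists_smul_eq_mk_rep ℂ u hu
  obtain ⟨b, hb⟩ := Projectivization.exists_smul_eq_mk_rep ℂ v hv
  have ha0 : ‖(a : ℂ)‖ ≠ 0 := norm_ne_zero_iff.mpr a.ne_zero
  have hb0 : ‖(b : ℂ)‖ ≠ 0 := norm_ne_zero_iff.mpr b.ne_zero
  have hu0 : ‖u‖ ≠ 0 := norm_ne_zero_iff.mpr hu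
  have hv0 : ‖v‖ ≠ 0 := norm_ne_zero_iff.mpr hv
  unfold quantumAngle
  rw [← ha, ← hb, Units.smul_def, Units.smul_def, inner_smul_left, inner_smul_right,
    norm_smul, norm_smul, norm_mul, norm_mul, RCLike.norm_conj]
  congr 1
  field_simp

/-- On lines spanned by unit vectors the quantum angle is `arccos |⟪u, v⟫|`. -/
theorem quantumAngle_mk_of_norm_eq_one (u v : H) (hu : u ≠ 0) (hv : v ≠ 0)
    (hu1 : ‖u‖ = 1) (hv1 : ‖v‖ = 1) :
    quantumAngle (Projectivization.mk ℂ u hu) (Projectivization.mk ℂ v hv) =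
      Real.arccos ‖inner ℂ u v‖ := by
  rw [quantumAngle_mk, hu1, hv1, mul_one, div_one]

/-- A self-map of the projective space is a Wigner symmetry if it is `[v] ↦ [U v]` for a unitary
(surjective linear isometry) or an antiunitary (surjective conjugate-linear isometry)
operator `U` on `H`. -/
def IsWignerSymmetry (φ : ℙ ℂ H → ℙ ℂ H) : Prop :=
  (∃ U : H ≃ₗᵢ[ℂ] H, ∀ (v : H) (hv : v ≠ 0),
    φ (Projectivization.mk ℂ v hv) =
      Projectivization.mk ℂ (U v) ((map_ne_zero_iff U U.injective).mpr hv)) ∨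
  (∃ U : H ≃ₛₗᵢ[starRingEnd ℂ] H, ∀ (v : H) (hv : v ≠ 0),
    φ (Projectivization.mk ℂ v hv) =
      Projectivization.mk ℂ (U v) ((map_ne_zero_iff U U.injective).mpr hv))

end QuantumAngle

/-!
The proof uses only the relation of having overlap `c = cos α`, where `0 < c` and `2 * c ^ 2 < 1`,
and the set `equiangular c S` of the points which have this relation to all points of `S`.

A great circle `F` on a line is *circle-like*: any three of its points have the same equiangular set
as `F`, and `F` is its own double equiangular set up to finitely many points. The points equiangular
to `F` are plentiful, because `2 * c ^ 2 < 1` leaves room for points which project to a pole of `F`.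
Conversely, a circle-like set lies on a line. If no three of its points were collinear, then all of
its equiangular points would lie in the plane of any three of its points, infinitely many of them
on one line, and the set would be covered by finitely many points of two polar lines. If three
points lie on a line `l`, then up to finitely many points the set contains a circle of `l`. If it
also contained a point outside of `l`, then turning the pole of that circle along `l` would lead to
a point which is equiangular to three points of the set, but not to all of them. Being circle-like
is preserved by `φ`, and for orthogonal points `N` and `N'` every point of the line `NN'` lies on a
great circle through `N` and `N'`. So `φ` maps lines into lines.

Moreover `φ` preserves orthogonality, since the points equiangular to a great circle lie on the
polars of its two poles. If a line `NN'` and a point `w` orthogonal to `N'` are given, then the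
overlap of `w` with a point of the line is the product of their overlaps with `N`. By varying `w`
one finds that the squared overlap of two images is a function `g` of the squared overlap of the
points. Pythagoras makes `g` additive on `[0, 1]`, and a bounded additive `g` with `g 1 = 1` is the
identity.

A map which preserves overlaps is read off in an affine chart `x ↦ [e + x]`. There it preserves
`|⟪x, y⟫|` and `|1 + ⟪x, y⟫|`, hence the real part of `⟪x, y⟫`. So it is real linear, and it maps
`i x` to the image of `x` multiplied by `i` or `-i`, with a sign that does not depend on `x`.
-/

section UnimodularNumbers

open Polynomial

theorem mul_star_self_of_norm_eq_one {z : ℂ} (hz : ‖z‖ = 1) : z * star z = 1 := by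
  rw [Complex.star_def, Complex.mul_conj', hz]
  norm_num

theorem norm_add_mul_sq (a b z : ℂ) (hz : ‖z‖ = 1) :
    ‖a + z * b‖ ^ 2 = ‖a‖ ^ 2 + ‖b‖ ^ 2 + 2 * (z * (b * star a)).re := by
  rw [norm_add_sq (𝕜 := ℂ), norm_mul, hz, RCLike.inner_apply, mul_assoc z b, one_mul]
  simp only [RCLike.re_to_complex, Complex.star_def]
  ring

theorem eq_of_re_mul_eq {μ z w : ℂ} (hμ : μ ≠ 0) (hz : ‖z‖ = 1) (hw : ‖w‖ = 1)
    (h : (z * μ).re = (w * μ).re) : z = w ∨ (z * μ).im = -(w * μ).im := by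
  have hnorm : ‖z * μ‖ ^ 2 = ‖w * μ‖ ^ 2 := by rw [norm_mul, norm_mul, hz, hw]
  rw [Complex.sq_norm, Complex.sq_norm, Complex.normSq_apply, Complex.normSq_apply, h,
    add_right_inj, mul_self_eq_mul_self_iff] at hnorm
  exact hnorm.imp_left fun him => mul_right_cancel₀ hμ (Complex.ext h him)

theorem eq_zero_of_re_mul_eq {μ z₁ z₂ z₃ : ℂ} {t : ℝ} (h₁ : ‖z₁‖ = 1) (h₂ : ‖z₂‖ = 1)
    (h₃ : ‖z₃‖ = 1) (h₁₂ : z₁ ≠ z₂) (h₁₃ : z₁ ≠ z₃) (h₂₃ : z₂ ≠ z₃)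
    (e₁ : (z₁ * μ).re = t) (e₂ : (z₂ * μ).re = t) (e₃ : (z₃ * μ).re = t) : μ = 0 := by
  by_contra hμ
  have h₁₂' := (eq_of_re_mul_eq hμ h₁ h₂ (e₁.trans e₂.symm)).resolve_left h₁₂
  have h₁₃' := (eq_of_re_mul_eq hμ h₁ h₃ (e₁.trans e₃.symm)).resolve_left h₁₃
  exact h₂₃ (mul_right_cancel₀ hμ (Complex.ext (e₂.trans e₃.symm) (by linarith)))

theorem eq_zero_or_eq_zero_of_norm_add_mul {a b z₁ z₂ z₃ : ℂ} {t : ℝ} (h₁ : ‖z₁‖ = 1)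
    (h₂ : ‖z₂‖ = 1) (h₃ : ‖z₃‖ = 1) (h₁₂ : z₁ ≠ z₂) (h₁₃ : z₁ ≠ z₃) (h₂₃ : z₂ ≠ z₃)
    (e₁ : ‖a + z₁ * b‖ = t) (e₂ : ‖a + z₂ * b‖ = t) (e₃ : ‖a + z₃ * b‖ = t) :
    a = 0 ∨ b = 0 := by
  have hre {z : ℂ} (hz : ‖z‖ = 1) (e : ‖a + z * b‖ = t) :
      (z * (b * star a)).re = (t ^ 2 - ‖a‖ ^ 2 - ‖b‖ ^ 2) / 2 := by
    linarith [e ▸ norm_add_mul_sq a b z hz]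
  have h := eq_zero_of_re_mul_eq h₁ h₂ h₃ h₁₂ h₁₃ h₂₃ (hre h₁ e₁) (hre h₂ e₂) (hre h₃ e₃)
  exact (mul_eq_zero.mp h).symm.imp_left star_eq_zero.mp

theorem exists_two_unimodular_re_mul_eq {μ : ℂ} {t : ℝ} (h : |t| < ‖μ‖) :
    ∃ z₁ z₂ : ℂ, ‖z₁‖ = 1 ∧ ‖z₂‖ = 1 ∧ z₁ ≠ z₂ ∧ (z₁ * μ).re = t ∧ (z₂ * μ).re = t := by
  have hμ : μ ≠ 0 := norm_pos_iff.mp ((abs_nonneg t).trans_lt h)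
  have hpos : 0 < ‖μ‖ ^ 2 - t ^ 2 := sub_pos.mpr (sq_lt_sq' (abs_lt.mp h).1 (abs_lt.mp h).2)
  have hnorm {s : ℝ} (hs : s ^ 2 = ‖μ‖ ^ 2 - t ^ 2) : ‖(⟨t, s⟩ : ℂ) / μ‖ = 1 := by
    rw [norm_div, div_eq_one_iff_eq (norm_ne_zero_iff.mpr hμ), ← sq_eq_sq₀ (norm_nonneg _)
      (norm_nonneg _), Complex.sq_norm, Complex.normSq_mk]
    linarith
  set s := √(‖μ‖ ^ 2 - t ^ 2)
  have hs : s ^ 2 = ‖μ‖ ^ 2 - t ^ 2 := Real.sq_sqrt hpos.le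
  refine ⟨⟨t, s⟩ / μ, ⟨t, -s⟩ / μ, hnorm hs, hnorm ((neg_sq s).trans hs), fun heq => ?_, ?_, ?_⟩
  · have him : s = -s := congrArg Complex.im ((div_left_inj' hμ).mp heq)
    linarith [Real.sqrt_pos.mpr hpos]
  all_goals rw [div_mul_cancel₀ _ hμ]

theorem exists_two_unimodular_norm_add_mul_eq {a b : ℂ} {t : ℝ} (h₁ : |‖a‖ - ‖b‖| < t)
    (h₂ : t < ‖a‖ + ‖b‖) :
    ∃ z₁ z₂ : ℂ, ‖z₁‖ = 1 ∧ ‖z₂‖ = 1 ∧ z₁ ≠ z₂ ∧ ‖a + z₁ * b‖ = t ∧ ‖a + z₂ * b‖ = t := by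
  have ht : 0 ≤ t := (abs_nonneg _).trans h₁.le
  have hlt : |(t ^ 2 - ‖a‖ ^ 2 - ‖b‖ ^ 2) / 2| < ‖b * star a‖ := by
    rw [norm_mul, norm_star]
    rw [abs_lt] at h₁ ⊢
    constructor <;> nlinarith
  obtain ⟨z₁, z₂, hz₁, hz₂, hne, e₁, e₂⟩ := exists_two_unimodular_re_mul_eq hlt
  refine ⟨z₁, z₂, hz₁, hz₂, hne, ?_, ?_⟩ <;>
    rw [← sq_eq_sq₀ (norm_nonneg _) ht, norm_add_mul_sq _ _ _ ‹_›]
  · linarith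
  · linarith

theorem infinite_unimodular_near_one {ε : ℝ} (hε : 0 < ε) :
    {z : ℂ | ‖z‖ = 1 ∧ ‖z - 1‖ < ε}.Infinite := by
  have hsphere : IsPreconnected (Metric.sphere (0 : ℂ) 1) :=
    isPreconnected_sphere (by simp [Complex.rank_real_complex]) 0 1
  have hnontrivial : (Metric.sphere (0 : ℂ) 1).Nontrivial :=
    ⟨1, by simp, -1, by simp, by norm_num⟩
  have hacc := (hsphere.preperfect_of_nontrivial hnontrivial 1 (by simp)).nhds_inter
    (Metric.ball_mem_nhds 1 hε)
  refine (Set.Infinite.of_accPt hacc).mono fun z hz => ?_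
  exact ⟨mem_sphere_zero_iff_norm.mp hz.2, mem_ball_iff_norm.mp hz.1⟩

theorem infinite_unimodular : {z : ℂ | ‖z‖ = 1}.Infinite :=
  (infinite_unimodular_near_one one_pos).mono fun _ hz => hz.1

theorem elimination_of_norm_eq_one {x y z a b : ℂ} (ha : ‖a‖ = 1) (hb : ‖b‖ = 1)
    (h : ‖x + y * a + z * b‖ = 1) :
    (x + y * a) * (star x * a + star y) + (star z * z - 1) * a =
      -(a * star b * star z * (x + y * a) + z * b * (star x * a + star y)) := by
  have h' := mul_star_self_of_norm_eq_one h
  simp only [star_add, star_mul] at h'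
  linear_combination a * h' -
    (x + y * a + z * b) * star y * mul_star_self_of_norm_eq_one ha -
    a * z * star z * mul_star_self_of_norm_eq_one hb

/- Eliminating `b` and `conj b` from the two equations leaves the resultant `P Q + a D² = 0`, a
polynomial equation for `a` that is nontrivial at `0`. -/
theorem finite_setOf_two_unimodular_equations {x y z x' y' z' : ℂ} (hx : x ≠ 0) (hy : y ≠ 0)
    (hx' : x' ≠ 0) (hy' : y' ≠ 0) (hxz : x * z' - x' * z ≠ 0) (hyz : y * z' - y' * z ≠ 0) :
    {a : ℂ | ‖a‖ = 1 ∧ ∃ b : ℂ, ‖b‖ = 1 ∧ ‖x + y * a + z * b‖ = 1 ∧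
      ‖x' + y' * a + z' * b‖ = 1}.Finite := by
  let A : ℂ[X] := C x + C y * X
  let A' : ℂ[X] := C x' + C y' * X
  let S : ℂ[X] := C (star x) * X + C (star y)
  let S' : ℂ[X] := C (star x') * X + C (star y')
  let β : ℂ[X] := A * S + C (star z * z - 1) * X
  let β' : ℂ[X] := A' * S' + C (star z' * z' - 1) * X
  let P : ℂ[X] := C (star z') * (β * A') - C (star z) * (β' * A)
  let Q : ℂ[X] := C z' * (β * S') - C z * (β' * S)
  let D : ℂ[X] := C (z * star z') * (S * A') - C (z' * star z) * (S' * A)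
  have heval : (P * Q + X * D ^ 2).eval 0 =
      (x * x' * star (y * z' - y' * z)) * (star y * star y' * (x * z' - x' * z)) := by
    simp only [A, A', S, S', β, β', P, Q, D, eval_add, eval_mul, eval_sub, eval_C, eval_X,
      eval_pow, star_sub, star_mul]
    ring
  have hne : P * Q + X * D ^ 2 ≠ 0 := by
    intro h0
    rw [h0, eval_zero] at heval
    exact mul_ne_zero (mul_ne_zero (mul_ne_zero hx hx') (star_ne_zero.mpr hyz))
      (mul_ne_zero (mul_ne_zero (star_ne_zero.mpr hy) (star_ne_zero.mpr hy')) hxz) heval.symm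
  refine (finite_setOfPred_isRoot hne).subset ?_
  rintro a ⟨ha, b, hb, e, e'⟩
  have hβ : β.eval a = -(a * star b * star z * A.eval a + z * b * S.eval a) := by
    simpa [A, S, β] using elimination_of_norm_eq_one ha hb e
  have hβ' : β'.eval a = -(a * star b * star z' * A'.eval a + z' * b * S'.eval a) := by
    simpa [A', S', β'] using elimination_of_norm_eq_one ha hb e'
  have hP : P.eval a = -b * D.eval a := by
    simp only [P, D, eval_sub, eval_mul, eval_C, hβ, hβ']
    ring
  have hQ : Q.eval a = a * star b * D.eval a := by
    simp only [Q, D, eval_sub, eval_mul, eval_C, hβ, hβ']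
    ring
  change (P * Q + X * D ^ 2).eval a = 0
  rw [eval_add, eval_mul, eval_mul, eval_pow, eval_X, hP, hQ]
  linear_combination -a * D.eval a ^ 2 * mul_star_self_of_norm_eq_one hb

end UnimodularNumbers

section Overlap

variable {H : Type*} [NormedAddCommGroup H] [InnerProductSpace ℂ H]

/-- The overlap of two lines is the cosine of their quantum angle: for unit vectors `u`, `v` the
overlap of `[u]` and `[v]` is `|⟪u, v⟫|`. -/
noncomputable def overlap (p q : ℙ ℂ H) : ℝ := Real.cos (quantumAngle p q)

theorem overlap_mk (u v : H) (hu : u ≠ 0) (hv : v ≠ 0) :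
    overlap (Projectivization.mk ℂ u hu) (Projectivization.mk ℂ v hv) =
      ‖inner ℂ u v‖ / (‖u‖ * ‖v‖) := by
  have hnonneg : 0 ≤ ‖inner ℂ u v‖ / (‖u‖ * ‖v‖) := by positivity
  rw [overlap, quantumAngle_mk, Real.cos_arccos (by linarith)
    (div_le_one_of_le₀ (norm_inner_le_norm _ _) (by positivity))]

theorem overlap_mk_eq_zero_iff {u v : H} {hu : u ≠ 0} {hv : v ≠ 0} :
    overlap (Projectivization.mk ℂ u hu) (Projectivization.mk ℂ v hv) = 0 ↔ inner ℂ u v = 0 := by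
  simp [overlap_mk, hu, hv]

theorem quantumAngle_eq_iff {p q : ℙ ℂ H} {α : ℝ} (hα₀ : 0 ≤ α) (hα : α ≤ Real.pi) :
    quantumAngle p q = α ↔ overlap p q = Real.cos α :=
  (Real.injOn_cos.eq_iff ⟨Real.arccos_nonneg _, Real.arccos_le_pi _⟩ ⟨hα₀, hα⟩).symm

/-- The line spanned by a unit vector. -/
noncomputable def ray (v : H) (hv : ‖v‖ = 1) : ℙ ℂ H :=
  Projectivization.mk ℂ v (ne_zero_of_norm_ne_zero (hv ▸ one_ne_zero))

theorem exists_ray (p : ℙ ℂ H) : ∃ (u : H) (hu : ‖u‖ = 1), ray u hu = p := by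
  induction p with | h v hv =>
  exact ⟨(‖v‖ : ℂ)⁻¹ • v, norm_smul_inv_norm hv,
    (Projectivization.mk_eq_mk_iff' ℂ _ _ _ _).mpr ⟨_, rfl⟩⟩

theorem ray_eq_ray_iff {u v : H} {hu : ‖u‖ = 1} {hv : ‖v‖ = 1} :
    ray u hu = ray v hv ↔ ∃ z : ℂ, z • v = u :=
  Projectivization.mk_eq_mk_iff' ℂ _ _ _ _

theorem overlap_ray {u v : H} (hu : ‖u‖ = 1) (hv : ‖v‖ = 1) :
    overlap (ray u hu) (ray v hv) = ‖inner ℂ u v‖ := by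
  rw [ray, ray, overlap_mk, hu, hv, mul_one, div_one]

theorem overlap_ray_eq_zero_iff {u v : H} {hu : ‖u‖ = 1} {hv : ‖v‖ = 1} :
    overlap (ray u hu) (ray v hv) = 0 ↔ inner ℂ u v = 0 :=
  overlap_mk_eq_zero_iff

theorem overlap_comm (p q : ℙ ℂ H) : overlap p q = overlap q p := by
  obtain ⟨u, hu, rfl⟩ := exists_ray p
  obtain ⟨v, hv, rfl⟩ := exists_ray q
  rw [overlap_ray, overlap_ray, norm_inner_symm]

theorem overlap_nonneg (p q : ℙ ℂ H) : 0 ≤ overlap p q := by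
  obtain ⟨u, hu, rfl⟩ := exists_ray p
  obtain ⟨v, hv, rfl⟩ := exists_ray q
  rw [overlap_ray]
  positivity

theorem overlap_le_one (p q : ℙ ℂ H) : overlap p q ≤ 1 := Real.cos_le_one _

theorem overlap_eq_one_iff {p q : ℙ ℂ H} : overlap p q = 1 ↔ p = q := by
  induction p with | h u hu =>
  induction q with | h v hv =>
  rw [overlap_mk, div_eq_one_iff_eq (by positivity), norm_inner_eq_norm_iff hu hv, eq_comm,
    Projectivization.mk_eq_mk_iff']
  refine ⟨fun ⟨r, _, hr⟩ => ⟨r, hr.symm⟩, fun ⟨r, hr⟩ => ⟨r, ?_, hr.symm⟩⟩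
  rintro rfl
  exact hv (by rw [← hr, zero_smul])

theorem overlap_self (p : ℙ ℂ H) : overlap p p = 1 := overlap_eq_one_iff.mpr rfl

theorem ne_of_overlap_eq_zero {p q : ℙ ℂ H} (h : overlap p q = 0) : p ≠ q := fun hpq =>
  zero_ne_one (h.symm.trans (overlap_eq_one_iff.mpr hpq))

end Overlap

section Lines

variable {H : Type*} [NormedAddCommGroup H] [InnerProductSpace ℂ H]

/-- The point `r` of the projective space lies on the projective line through `p` and `q`. For
`p = q` this degenerates to `r = p`. -/
def OnLine (p q r : ℙ ℂ H) : Prop := r.submodule ≤ p.submodule ⊔ q.submodule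

variable {p q r x y z : ℙ ℂ H}

theorem onLine_left (p q : ℙ ℂ H) : OnLine p q p := le_sup_left

theorem onLine_right (p q : ℙ ℂ H) : OnLine p q q := le_sup_right

theorem onLine_mk_iff {u v w : H} {hu : u ≠ 0} {hv : v ≠ 0} {hw : w ≠ 0} :
    OnLine (Projectivization.mk ℂ u hu) (Projectivization.mk ℂ v hv)
      (Projectivization.mk ℂ w hw) ↔ ∃ a b : ℂ, a • u + b • v = w := by
  rw [OnLine, Projectivization.submodule_mk, Projectivization.submodule_mk,
    Projectivization.submodule_mk, Submodule.span_singleton_le_iff_mem, ← Submodule.span_insert,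
    Submodule.mem_span_pair]

theorem finrank_submodule_sup_submodule (hpq : p ≠ q) :
    Module.finrank ℂ ↥(p.submodule ⊔ q.submodule) = 2 := by
  have hdisjoint : p.submodule ⊓ q.submodule = ⊥ := by
    rw [p.submodule_eq, q.submodule_eq, ← disjoint_iff, Submodule.disjoint_span_singleton'
      q.rep_nonzero, Submodule.mem_span_singleton]
    rintro ⟨a, ha⟩
    refine hpq ?_
    rw [← p.mk_rep, ← q.mk_rep, eq_comm, Projectivization.mk_eq_mk_iff']
    exact ⟨a, ha⟩
  have h := Submodule.finrank_sup_add_finrank_inf_eq p.submodule q.submodule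
  rwa [hdisjoint, finrank_bot, p.finrank_submodule, q.finrank_submodule] at h

theorem finrank_submodule_sup_submodule_le (p q : ℙ ℂ H) :
    Module.finrank ℂ ↥(p.submodule ⊔ q.submodule) ≤ 2 := by
  have h := Submodule.finrank_add_le_finrank_add_finrank p.submodule q.submodule
  rwa [p.finrank_submodule, q.finrank_submodule] at h

theorem OnLine.submodule_sup_submodule_eq (hx : OnLine p q x) (hy : OnLine p q y) (hxy : x ≠ y) :
    x.submodule ⊔ y.submodule = p.submodule ⊔ q.submodule :=
  Submodule.eq_of_le_of_finrank_le (sup_le hx hy) <|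
    (finrank_submodule_sup_submodule_le p q).trans (finrank_submodule_sup_submodule hxy).ge

theorem OnLine.exchange (hx : OnLine p q x) (hy : OnLine p q y) (hxy : x ≠ y)
    (hz : OnLine p q z) : OnLine x y z := by
  rwa [OnLine, hx.submodule_sup_submodule_eq hy hxy]

theorem OnLine.symm (h : OnLine p q r) : OnLine q p r := h.trans_eq (sup_comm _ _)

theorem isOrtho_submodule_iff : p.submodule ⟂ q.submodule ↔ overlap p q = 0 := by
  induction p with | h u hu =>
  induction q with | h v hv =>
  rw [overlap_mk_eq_zero_iff, Projectivization.submodule_mk, Projectivization.submodule_mk,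
    Submodule.isOrtho_span]
  simp only [Set.mem_singleton_iff, forall_eq]

theorem OnLine.overlap_eq_zero (hr : OnLine p q r) (hp : overlap p x = 0) (hq : overlap q x = 0) :
    overlap r x = 0 :=
  isOrtho_submodule_iff.mp <| (Submodule.isOrtho_sup_left.mpr
    ⟨isOrtho_submodule_iff.mpr hp, isOrtho_submodule_iff.mpr hq⟩).mono_left hr

theorem exists_overlap_eq_zero_of_not_onLine (h : ¬OnLine p q r) :
    ∃ y, overlap p y = 0 ∧ overlap q y = 0 ∧ overlap r y ≠ 0 := by
  have hr : ¬r.submodule ≤ (p.submodule ⊔ q.submodule)ᗮᗮ := by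
    rwa [Submodule.orthogonal_orthogonal]
  obtain ⟨u, hu, rfl⟩ := exists_ray r
  rw [ray, Projectivization.submodule_mk, Submodule.span_singleton_le_iff_mem,
    Submodule.mem_orthogonal] at hr
  push Not at hr
  obtain ⟨v, hv, hvu⟩ := hr
  have hv0 : v ≠ 0 := by
    rintro rfl
    exact hvu (inner_zero_left u)
  have hortho : p.submodule ⊔ q.submodule ⟂ (Projectivization.mk ℂ v hv0).submodule :=
    Submodule.IsOrtho.symm ((Submodule.span_singleton_le_iff_mem _ _).mpr hv)
  rw [Submodule.isOrtho_sup_left, isOrtho_submodule_iff, isOrtho_submodule_iff] at hortho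
  exact ⟨_, hortho.1, hortho.2, fun h => hvu (inner_eq_zero_symm.mp (overlap_mk_eq_zero_iff.mp h))⟩

theorem exists_not_onLine (hdim : 3 ≤ Module.rank ℂ H) (p q : ℙ ℂ H) : ∃ r, ¬OnLine p q r := by
  by_contra! hall
  have htop : p.submodule ⊔ q.submodule = ⊤ := by
    refine Submodule.eq_top_iff'.mpr fun v => ?_
    rcases eq_or_ne v 0 with rfl | hv
    · exact zero_mem _
    · exact hall (Projectivization.mk ℂ v hv) (Submodule.mem_span_singleton_self v)
  have hrank : Module.rank ℂ H ≤ (2 : ℕ) := by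
    rw [← rank_top, ← htop, ← Module.finrank_eq_rank]
    exact_mod_cast finrank_submodule_sup_submodule_le p q
  exact absurd (hdim.trans hrank) (by norm_num)

theorem exists_overlap_eq_zero (hdim : 3 ≤ Module.rank ℂ H) (p q : ℙ ℂ H) :
    ∃ r, overlap p r = 0 ∧ overlap q r = 0 := by
  obtain ⟨x, hx⟩ := exists_not_onLine hdim p q
  obtain ⟨r, hp, hq, -⟩ := exists_overlap_eq_zero_of_not_onLine hx
  exact ⟨r, hp, hq⟩

theorem exists_onLine_overlap_eq_zero (hpq : p ≠ q) (x : ℙ ℂ H) :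
    ∃ y, OnLine p q y ∧ overlap y x = 0 := by
  rcases eq_or_ne (overlap p x) 0 with hpx | hpx
  · exact ⟨p, onLine_left p q, hpx⟩
  induction p with | h u hu =>
  induction q with | h v hv =>
  induction x with | h w hw =>
  have huw : inner ℂ w u ≠ 0 := fun h =>
    hpx (overlap_mk_eq_zero_iff.mpr (inner_eq_zero_symm.mp h))
  have hne : inner ℂ w v • u - inner ℂ w u • v ≠ 0 := fun h =>
    hpq <| ((Projectivization.mk_eq_mk_iff' ℂ _ _ _ _).mpr
      ⟨(inner ℂ w u)⁻¹ * inner ℂ w v, by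
        rw [mul_smul, sub_eq_zero.mp h, inv_smul_smul₀ huw]⟩).symm
  refine ⟨Projectivization.mk ℂ _ hne, onLine_mk_iff.mpr ⟨inner ℂ w v, -inner ℂ w u, by module⟩, ?_⟩
  rw [overlap_mk_eq_zero_iff, inner_eq_zero_symm, inner_sub_right, inner_smul_right,
    inner_smul_right]
  ring

theorem exists_adapted_pair (hpq : p ≠ q) (w : ℙ ℂ H) :
    ∃ x y, OnLine p q x ∧ OnLine p q y ∧ overlap x y = 0 ∧ overlap y w = 0 := by
  obtain ⟨y, hy, hyw⟩ := exists_onLine_overlap_eq_zero hpq w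
  obtain ⟨x, hx, hxy⟩ := exists_onLine_overlap_eq_zero hpq y
  exact ⟨x, y, hx, hy, hxy, hyw⟩

theorem norm_smul_add_smul_sq {e₁ e₂ : H} (h₁ : ‖e₁‖ = 1) (h₂ : ‖e₂‖ = 1)
    (h : inner ℂ e₁ e₂ = 0) (a b : ℂ) : ‖a • e₁ + b • e₂‖ ^ 2 = ‖a‖ ^ 2 + ‖b‖ ^ 2 := by
  have hortho : inner ℂ (a • e₁) (b • e₂) = 0 := by
    rw [inner_smul_left, inner_smul_right, h, mul_zero, mul_zero]
  rw [sq, norm_add_sq_eq_norm_sq_add_norm_sq_of_inner_eq_zero _ _ hortho, norm_smul, norm_smul,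
    h₁, h₂, mul_one, mul_one, ← sq, ← sq]

theorem norm_sub_inner_smul_add_inner_smul_sq {e₁ e₂ : H} (h₁ : ‖e₁‖ = 1) (h₂ : ‖e₂‖ = 1)
    (h : inner ℂ e₁ e₂ = 0) (v : H) :
    ‖v - (inner ℂ e₁ v • e₁ + inner ℂ e₂ v • e₂)‖ ^ 2 =
      ‖v‖ ^ 2 - (‖inner ℂ e₁ v‖ ^ 2 + ‖inner ℂ e₂ v‖ ^ 2) := by
  rw [@norm_sub_sq ℂ, norm_smul_add_smul_sq h₁ h₂ h, inner_add_right, inner_smul_right,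
    inner_smul_right, map_add, inner_mul_symm_re_eq_norm, inner_mul_symm_re_eq_norm, norm_mul,
    norm_mul, norm_inner_symm v e₁, norm_inner_symm v e₂]
  ring

theorem OnLine.eq_inner_smul_add_inner_smul {e₁ e₂ v : H} {h₁ : ‖e₁‖ = 1} {h₂ : ‖e₂‖ = 1}
    {hv : ‖v‖ = 1} (h : inner ℂ e₁ e₂ = 0) (hline : OnLine (ray e₁ h₁) (ray e₂ h₂) (ray v hv)) :
    v = inner ℂ e₁ v • e₁ + inner ℂ e₂ v • e₂ := by
  obtain ⟨a, b, rfl⟩ := onLine_mk_iff.mp hline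
  simp only [inner_add_right, inner_smul_right, h, inner_eq_zero_symm.mp h,
    inner_self_eq_one_of_norm_eq_one h₁, inner_self_eq_one_of_norm_eq_one h₂, mul_zero, mul_one,
    add_zero, zero_add]

theorem onLine_iff_overlap_sq_add_overlap_sq (h : overlap p q = 0) :
    OnLine p q r ↔ overlap p r ^ 2 + overlap q r ^ 2 = 1 := by
  obtain ⟨e₁, h₁, rfl⟩ := exists_ray p
  obtain ⟨e₂, h₂, rfl⟩ := exists_ray q
  obtain ⟨v, hv, rfl⟩ := exists_ray r
  rw [overlap_ray_eq_zero_iff] at h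
  have hdist := norm_sub_inner_smul_add_inner_smul_sq h₁ h₂ h v
  rw [overlap_ray, overlap_ray]
  constructor
  · intro hline
    rw [← hline.eq_inner_smul_add_inner_smul h, sub_self, norm_zero, hv] at hdist
    linarith
  · intro hsum
    rw [hsum, hv, one_pow, sub_self, sq_eq_zero_iff, norm_eq_zero, sub_eq_zero] at hdist
    exact onLine_mk_iff.mpr ⟨_, _, hdist.symm⟩

theorem OnLine.overlap_eq_mul (h : overlap p q = 0) (hr : OnLine p q r) (hx : overlap q x = 0) :
    overlap r x = overlap p r * overlap p x := by
  obtain ⟨e₁, h₁, rfl⟩ := exists_ray p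
  obtain ⟨e₂, h₂, rfl⟩ := exists_ray q
  obtain ⟨v, hv, rfl⟩ := exists_ray r
  obtain ⟨w, hw, rfl⟩ := exists_ray x
  rw [overlap_ray_eq_zero_iff] at h hx
  rw [overlap_ray, overlap_ray, overlap_ray]
  conv_lhs => rw [hr.eq_inner_smul_add_inner_smul h]
  rw [inner_add_left, inner_smul_left, inner_smul_left, hx, mul_zero, add_zero, norm_mul,
    RCLike.norm_conj]

theorem OnLine.eq_of_overlap_eq_zero (h : overlap p q = 0) (hr : OnLine p q r)
    (hqr : overlap q r = 0) : p = r := by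
  rw [onLine_iff_overlap_sq_add_overlap_sq h, hqr] at hr
  exact overlap_eq_one_iff.mp (by nlinarith [overlap_nonneg p r])

theorem onLine_of_overlap_eq_zero {E : Submodule ℂ H} [FiniteDimensional ℂ E]
    (hE : Module.finrank ℂ E ≤ 3) (hp : p.submodule ≤ E) (hx : x.submodule ≤ E)
    (hy : y.submodule ≤ E) (hz : z.submodule ≤ E) (hpx : overlap p x = 0) (hpy : overlap p y = 0)
    (hpz : overlap p z = 0) (hxy : x ≠ y) : OnLine x y z := by
  have hsub {w : ℙ ℂ H} (hw : w.submodule ≤ E) (hpw : overlap p w = 0) :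
      w.submodule ≤ E ⊓ p.submoduleᗮ := le_inf hw (isOrtho_submodule_iff.mpr hpw).symm
  have hlt : E ⊓ p.submoduleᗮ < E := by
    refine inf_le_left.lt_of_ne fun h => ?_
    have hself : p.submodule ⟂ p.submodule := hp.trans (inf_eq_left.mp h)
    rw [isOrtho_submodule_iff, overlap_self] at hself
    exact one_ne_zero hself
  have hrank := Submodule.finrank_lt_finrank_of_lt hlt
  rw [OnLine, Submodule.eq_of_le_of_finrank_le (sup_le (hsub hx hpx) (hsub hy hpy))
    (by rw [finrank_submodule_sup_submodule hxy]; omega)]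
  exact hsub hz hpz

end Lines

theorem two_lt_encard_iff {α : Type*} {S : Set α} :
    2 < S.encard ↔ ∃ x y z, x ∈ S ∧ y ∈ S ∧ z ∈ S ∧ x ≠ y ∧ x ≠ z ∧ y ≠ z := by
  rw [← ENat.add_one_le_iff (by simp), two_add_one_eq_three]
  constructor
  · intro h
    obtain ⟨T, hTS, hT⟩ := Set.exists_subset_encard_eq h
    obtain ⟨x, y, z, hxy, hxz, hyz, rfl⟩ := Set.encard_eq_three.mp hT
    exact ⟨x, y, z, hTS (by simp), hTS (by simp), hTS (by simp), hxy, hxz, hyz⟩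
  · rintro ⟨x, y, z, hx, hy, hz, hxy, hxz, hyz⟩
    rw [← Set.encard_eq_three.mpr ⟨x, y, z, hxy, hxz, hyz, rfl⟩]
    refine Set.encard_le_encard ?_
    rintro _ (rfl | rfl | rfl) <;> assumption

theorem two_lt_encard_of_infinite {α : Type*} {S : Set α} (hS : S.Infinite) : 2 < S.encard := by
  rw [hS.encard_eq]
  exact ENat.natCast_lt_top 2

section LatitudeCircles

variable {H : Type*} [NormedAddCommGroup H] [InnerProductSpace ℂ H]

/-- The points which have overlap `c` with every point of `S`. -/
def equiangular (c : ℝ) (S : Set (ℙ ℂ H)) : Set (ℙ ℂ H) := {w | ∀ p ∈ S, overlap p w = c}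

theorem equiangular_anti {c : ℝ} {S T : Set (ℙ ℂ H)} (h : S ⊆ T) :
    equiangular c T ⊆ equiangular c S := fun _ hw p hp => hw p (h hp)

/-- The points of the projective line `NN'` which have overlap `k` with `N`. For orthogonal `N` and
`N'` this is a circle of latitude on the Bloch sphere with poles `N` and `N'`. -/
def latitudeCircle (k : ℝ) (N N' : ℙ ℂ H) : Set (ℙ ℂ H) := {p | OnLine N N' p ∧ overlap N p = k}

/-- For orthonormal `e₁`, `e₂` and unimodular `z`, a unit vector spanning the point of longitude `z`
on the circle of latitude `k` with poles `[e₁]` and `[e₂]`. -/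
noncomputable def latitudeVector (k : ℝ) (e₁ e₂ : H) (z : ℂ) : H :=
  (k : ℂ) • e₁ + (√(1 - k ^ 2) * z : ℂ) • e₂

variable {k c t : ℝ} {e₁ e₂ : H} {N N' p q w x : ℙ ℂ H} {S : Set (ℙ ℂ H)}

theorem norm_latitudeVector (h₁ : ‖e₁‖ = 1) (h₂ : ‖e₂‖ = 1) (h : inner ℂ e₁ e₂ = 0)
    (hk₀ : 0 ≤ k) (hk₁ : k ≤ 1) {z : ℂ} (hz : ‖z‖ = 1) : ‖latitudeVector k e₁ e₂ z‖ = 1 := by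
  rw [← sq_eq_sq₀ (norm_nonneg _) zero_le_one, latitudeVector, norm_smul_add_smul_sq h₁ h₂ h,
    norm_mul, hz, mul_one, Complex.norm_real, Complex.norm_real, Real.norm_eq_abs,
    Real.norm_eq_abs, sq_abs, sq_abs, Real.sq_sqrt (by nlinarith)]
  ring

theorem inner_latitudeVector (v : H) (z : ℂ) :
    inner ℂ v (latitudeVector k e₁ e₂ z) =
      k * inner ℂ v e₁ + z * (√(1 - k ^ 2) * inner ℂ v e₂) := by
  rw [latitudeVector, inner_add_right, inner_smul_right, inner_smul_right]
  ring

theorem ray_latitudeVector_mem_latitudeCircle {h₁ : ‖e₁‖ = 1} {h₂ : ‖e₂‖ = 1}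
    (h : inner ℂ e₁ e₂ = 0) (hk : 0 ≤ k) {z : ℂ} (hv : ‖latitudeVector k e₁ e₂ z‖ = 1) :
    ray (latitudeVector k e₁ e₂ z) hv ∈ latitudeCircle k (ray e₁ h₁) (ray e₂ h₂) := by
  refine ⟨onLine_mk_iff.mpr ⟨_, _, rfl⟩, ?_⟩
  rw [overlap_ray, inner_latitudeVector, h, inner_self_eq_one_of_norm_eq_one h₁, mul_zero,
    mul_zero, mul_one, add_zero, Complex.norm_real, Real.norm_of_nonneg hk]

theorem overlap_right_of_mem_latitudeCircle (h : overlap N N' = 0)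
    (hp : p ∈ latitudeCircle k N N') : overlap N' p = √(1 - k ^ 2) := by
  rw [← Real.sqrt_sq (overlap_nonneg N' p),
    ← (onLine_iff_overlap_sq_add_overlap_sq h).mp hp.1, hp.2, add_sub_cancel_left]

theorem exists_ray_latitudeVector_eq {h₁ : ‖e₁‖ = 1} {h₂ : ‖e₂‖ = 1} (h : inner ℂ e₁ e₂ = 0)
    (hp : p ∈ latitudeCircle k (ray e₁ h₁) (ray e₂ h₂)) :
    ∃ (z : ℂ) (hv : ‖latitudeVector k e₁ e₂ z‖ = 1), ‖z‖ = 1 ∧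
      ray (latitudeVector k e₁ e₂ z) hv = p := by
  have hp₂ := overlap_right_of_mem_latitudeCircle (overlap_ray_eq_zero_iff.mpr h) hp
  obtain ⟨hline, hp₁⟩ := hp
  have hk₀ : 0 ≤ k := hp₁ ▸ overlap_nonneg _ _
  have hk₁ : k ≤ 1 := hp₁ ▸ overlap_le_one _ _
  obtain ⟨v, hv, rfl⟩ := exists_ray p
  rw [overlap_ray] at hp₁ hp₂
  obtain ⟨a, ha, ha'⟩ := RCLike.exists_norm_mul_eq_self (inner ℂ e₁ v)
  obtain ⟨b, hb, hb'⟩ := RCLike.exists_norm_mul_eq_self (inner ℂ e₂ v)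
  have hz : ‖star a * b‖ = 1 := by rw [norm_mul, norm_star, ha, hb, mul_one]
  refine ⟨star a * b, norm_latitudeVector h₁ h₂ h hk₀ hk₁ hz, hz,
    ray_eq_ray_iff.mpr ⟨star a, ?_⟩⟩
  rw [hline.eq_inner_smul_add_inner_smul h, ← ha', ← hb', hp₁, hp₂, latitudeVector, smul_add,
    smul_smul, smul_smul, ← mul_assoc, mul_comm (star a) a, mul_star_self_of_norm_eq_one ha,
    one_mul]
  congr 2
  rw [RCLike.ofReal_eq_complex_ofReal]
  ring

theorem ray_latitudeVector_injective (h₁ : ‖e₁‖ = 1) (h₂ : ‖e₂‖ = 1) (h : inner ℂ e₁ e₂ = 0)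
    (hk₀ : 0 < k) (hk₁ : k < 1) {z w : ℂ} {hz : ‖latitudeVector k e₁ e₂ z‖ = 1}
    {hw : ‖latitudeVector k e₁ e₂ w‖ = 1} (hzw : ray _ hz = ray _ hw) : z = w := by
  have hτ : (√(1 - k ^ 2) : ℂ) ≠ 0 :=
    Complex.ofReal_ne_zero.mpr (Real.sqrt_pos.mpr (by nlinarith)).ne'
  have hk : (k : ℂ) ≠ 0 := Complex.ofReal_ne_zero.mpr hk₀.ne'
  obtain ⟨a, ha⟩ := ray_eq_ray_iff.mp hzw
  have hcoord₁ := congrArg (inner ℂ e₁) ha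
  have hcoord₂ := congrArg (inner ℂ e₂) ha
  simp only [inner_smul_right, inner_latitudeVector, h, inner_eq_zero_symm.mp h,
    inner_self_eq_one_of_norm_eq_one h₁, inner_self_eq_one_of_norm_eq_one h₂, mul_zero, mul_one,
    add_zero, zero_add] at hcoord₁ hcoord₂
  rw [mul_eq_right₀ hk] at hcoord₁
  rw [hcoord₁, one_mul, mul_left_inj' hτ] at hcoord₂
  exact hcoord₂.symm

theorem infinite_latitudeCircle (h : overlap N N' = 0) (hk₀ : 0 < k) (hk₁ : k < 1) :
    (latitudeCircle k N N').Infinite := by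
  obtain ⟨e₁, h₁, rfl⟩ := exists_ray N
  obtain ⟨e₂, h₂, rfl⟩ := exists_ray N'
  rw [overlap_ray_eq_zero_iff] at h
  have hnorm (z : {z : ℂ | ‖z‖ = 1}) := norm_latitudeVector h₁ h₂ h hk₀.le hk₁.le z.2
  have hinj : Function.Injective fun z => ray _ (hnorm z) := fun z w hzw =>
    Subtype.ext (ray_latitudeVector_injective h₁ h₂ h hk₀ hk₁ hzw)
  have := infinite_unimodular.to_subtype
  refine (Set.infinite_range_of_injective hinj).mono ?_
  rintro _ ⟨z, rfl⟩
  exact ray_latitudeVector_mem_latitudeCircle h hk₀.le _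

theorem exists_two_mem_latitudeCircle_overlap_eq (h : overlap N N' = 0) (hk₀ : 0 < k) (hk₁ : k < 1)
    (ht₁ : |k * overlap N x - √(1 - k ^ 2) * overlap N' x| < t)
    (ht₂ : t < k * overlap N x + √(1 - k ^ 2) * overlap N' x) :
    ∃ p ∈ latitudeCircle k N N', ∃ q ∈ latitudeCircle k N N', p ≠ q ∧ overlap p x = t ∧
      overlap q x = t := by
  obtain ⟨e₁, h₁, rfl⟩ := exists_ray N
  obtain ⟨e₂, h₂, rfl⟩ := exists_ray N'
  obtain ⟨v, hv, rfl⟩ := exists_ray x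
  rw [overlap_ray_eq_zero_iff] at h
  have hnorm₁ : ‖(k * inner ℂ v e₁ : ℂ)‖ = k * overlap (ray e₁ h₁) (ray v hv) := by
    rw [norm_mul, Complex.norm_real, Real.norm_of_nonneg hk₀.le, overlap_ray, norm_inner_symm]
  have hnorm₂ : ‖(√(1 - k ^ 2) * inner ℂ v e₂ : ℂ)‖ =
      √(1 - k ^ 2) * overlap (ray e₂ h₂) (ray v hv) := by
    rw [norm_mul, Complex.norm_real, Real.norm_of_nonneg (Real.sqrt_nonneg _), overlap_ray,
      norm_inner_symm]
  rw [← hnorm₁, ← hnorm₂] at ht₁ ht₂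
  obtain ⟨z, w, hz, hw, hzw, hz', hw'⟩ := exists_two_unimodular_norm_add_mul_eq ht₁ ht₂
  have hnorm {z : ℂ} (hz : ‖z‖ = 1) := norm_latitudeVector h₁ h₂ h hk₀.le hk₁.le hz
  refine ⟨ray _ (hnorm hz), ray_latitudeVector_mem_latitudeCircle h hk₀.le _, ray _ (hnorm hw),
    ray_latitudeVector_mem_latitudeCircle h hk₀.le _,
    fun heq => hzw (ray_latitudeVector_injective h₁ h₂ h hk₀ hk₁ heq), ?_, ?_⟩ <;>
  rwa [overlap_ray, norm_inner_symm, inner_latitudeVector]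

theorem overlap_eq_mul_of_mem_latitudeCircle (h : overlap N N' = 0)
    (hp : p ∈ latitudeCircle k N N') (hx : overlap N' x = 0) : overlap p x = k * overlap N x := by
  rw [hp.1.overlap_eq_mul h hx, hp.2]

theorem overlap_eq_sqrt_mul_of_mem_latitudeCircle (h : overlap N N' = 0)
    (hp : p ∈ latitudeCircle k N N') (hx : overlap N x = 0) :
    overlap p x = √(1 - k ^ 2) * overlap N' x := by
  rw [hp.1.symm.overlap_eq_mul ((overlap_comm _ _).trans h) hx,
    overlap_right_of_mem_latitudeCircle h hp]

theorem overlap_eq_of_mem_latitudeCircle (h : overlap N N' = 0) (hp : p ∈ latitudeCircle k N N')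
    (hq : q ∈ latitudeCircle k N N') (hx : overlap N x = 0 ∨ overlap N' x = 0) :
    overlap p x = overlap q x := by
  rcases hx with hx | hx
  · rw [overlap_eq_sqrt_mul_of_mem_latitudeCircle h hp hx,
      overlap_eq_sqrt_mul_of_mem_latitudeCircle h hq hx]
  · rw [overlap_eq_mul_of_mem_latitudeCircle h hp hx, overlap_eq_mul_of_mem_latitudeCircle h hq hx]

theorem overlap_eq_zero_or_of_mem_equiangular (h : overlap N N' = 0) (hk : 0 < k)
    (hS : S ⊆ latitudeCircle k N N') (hcard : 2 < S.encard) (hx : x ∈ equiangular t S) :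
    overlap N x = 0 ∨ overlap N' x = 0 := by
  obtain ⟨s₁, s₂, s₃, m₁, m₂, m₃, h₁₂, h₁₃, h₂₃⟩ := two_lt_encard_iff.mp hcard
  have hx₁ := hx s₁ m₁
  have hx₂ := hx s₂ m₂
  have hx₃ := hx s₃ m₃
  obtain ⟨e₁, h₁, rfl⟩ := exists_ray N
  obtain ⟨e₂, h₂, rfl⟩ := exists_ray N'
  obtain ⟨v, hv, rfl⟩ := exists_ray x
  rw [overlap_ray_eq_zero_iff] at h
  obtain ⟨z₁, n₁, hz₁, rfl⟩ := exists_ray_latitudeVector_eq h (hS m₁)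
  obtain ⟨z₂, n₂, hz₂, rfl⟩ := exists_ray_latitudeVector_eq h (hS m₂)
  obtain ⟨z₃, n₃, hz₃, rfl⟩ := exists_ray_latitudeVector_eq h (hS m₃)
  rw [overlap_ray, norm_inner_symm, inner_latitudeVector] at hx₁ hx₂ hx₃
  have hτ : (√(1 - k ^ 2) : ℂ) ≠ 0 := fun hτ => h₁₂ <| by
    simp only [latitudeVector, hτ, zero_mul]
  have hlongitude := eq_zero_or_eq_zero_of_norm_add_mul hz₁ hz₂ hz₃
    (by rintro rfl; exact h₁₂ rfl) (by rintro rfl; exact h₁₃ rfl)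
    (by rintro rfl; exact h₂₃ rfl) hx₁ hx₂ hx₃
  rw [mul_eq_zero_iff_left (Complex.ofReal_ne_zero.mpr hk.ne'), mul_eq_zero_iff_left hτ]
    at hlongitude
  rwa [overlap_comm, overlap_ray_eq_zero_iff, overlap_comm (ray e₂ h₂), overlap_ray_eq_zero_iff]

theorem exists_poles (hpq : p ≠ q) (hS : ∀ s ∈ S, OnLine p q s) (hne : S.Nonempty) (hc : 0 < c)
    (hw : w ∈ equiangular c S) :
    ∃ N N', OnLine p q N ∧ OnLine p q N' ∧ overlap N N' = 0 ∧ overlap N' w = 0 ∧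
      0 < overlap N w ∧ S ⊆ latitudeCircle (c / overlap N w) N N' := by
  obtain ⟨N, N', hN, hN', h, hN'w⟩ := exists_adapted_pair hpq w
  have hmul {s : ℙ ℂ H} (hs : s ∈ S) : OnLine N N' s ∧ overlap N s * overlap N w = c := by
    have hline := hN.exchange hN' (ne_of_overlap_eq_zero h) (hS s hs)
    exact ⟨hline, (hline.overlap_eq_mul h hN'w).symm.trans (hw s hs)⟩
  obtain ⟨s₀, hs₀⟩ := hne
  have hNw : 0 < overlap N w := (overlap_nonneg N w).lt_of_ne fun h0 => hc.ne <| by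
    rw [← (hmul hs₀).2, ← h0, mul_zero]
  exact ⟨N, N', hN, hN', h, hN'w, hNw, fun s hs =>
    ⟨(hmul hs).1, eq_div_of_mul_eq hNw.ne' (hmul hs).2⟩⟩

end LatitudeCircles

section EquimodularVectors

variable {H : Type*} [NormedAddCommGroup H] [InnerProductSpace ℂ H] {ι : Type*}

theorem exists_biorthogonal [Finite ι] [DecidableEq ι] {p : ι → H} (hp : LinearIndependent ℂ p) :
    ∃ q : ι → H, (∀ k, q k ∈ Submodule.span ℂ (Set.range p)) ∧
      ∀ j k, inner ℂ (p j) (q k) = if j = k then 1 else 0 := by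
  have := FiniteDimensional.span_of_finite ℂ (Set.finite_range p)
  let b := Module.Basis.span hp
  refine ⟨fun k => (InnerProductSpace.toDual ℂ
    (Submodule.span ℂ (Set.range p))).symm (b.coord k).toContinuousLinearMap,
    fun k => Subtype.property _, fun j k => ?_⟩
  have hb : p j = b j := congrArg Subtype.val (Module.Basis.span_apply hp j).symm
  rw [hb, ← Submodule.coe_inner, ← inner_conj_symm, InnerProductSpace.toDual_symm_apply,
    LinearMap.coe_toContinuousLinearMap', Module.Basis.coord_apply, b.repr_self,
    Finsupp.single_apply, apply_ite (starRingEnd ℂ), map_one, map_zero]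

/-- The vectors `v` in the open unit ball of the span of the family `p` with `|⟪p j, v⟫| = c` for
all `j`. If `p` does not span `H`, these are the orthogonal projections of the unit vectors outside
the span which satisfy the same equations. -/
def equimodularBall (c : ℝ) (p : ι → H) : Set H :=
  {v | v ∈ Submodule.span ℂ (Set.range p) ∧ ‖v‖ < 1 ∧ ∀ j, ‖inner ℂ (p j) v‖ = c}

variable {c : ℝ} {p : ι → H}

theorem exists_rotation_mem_equimodularBall {k : ι} {q w : H}
    (hq : q ∈ Submodule.span ℂ (Set.range p)) (hk : inner ℂ (p k) q = 1)
    (hj : ∀ j, j ≠ k → inner ℂ (p j) q = 0) (hw : w ∈ equimodularBall c p) :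
    ∃ ε > 0, ∀ ζ : ℂ, ‖ζ‖ = 1 → ‖ζ - 1‖ < ε →
      w + ((ζ - 1) * inner ℂ (p k) w) • q ∈ equimodularBall c p := by
  obtain ⟨hwE, hw₁, hwc⟩ := hw
  have hd : 0 < ‖inner ℂ (p k) w‖ * ‖q‖ + 1 := by positivity
  refine ⟨(1 - ‖w‖) / (‖inner ℂ (p k) w‖ * ‖q‖ + 1), div_pos (sub_pos.mpr hw₁) hd,
    fun ζ hζ hζ₁ => ⟨add_mem hwE (Submodule.smul_mem _ _ hq), ?_, fun j => ?_⟩⟩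
  · rw [lt_div_iff₀ hd] at hζ₁
    have h := norm_add_le w (((ζ - 1) * inner ℂ (p k) w) • q)
    rw [norm_smul, norm_mul] at h
    linarith [norm_nonneg (ζ - 1)]
  · rw [inner_add_right, inner_smul_right]
    rcases eq_or_ne j k with rfl | hjk
    · rw [hk, ← hwc j, mul_one, ← one_add_mul, add_sub_cancel, norm_mul, hζ, one_mul]
    · rw [hj j hjk, mul_zero, add_zero, hwc]

theorem exists_inner_rotation_mem_equimodularBall [Fintype ι] (hp : LinearIndependent ℂ p)
    {w : H} (hw : w ∈ equimodularBall c p) (α : ι → ℂ) (k : ι) :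
    ∃ ε > 0, ∀ ζ : ℂ, ‖ζ‖ = 1 → ‖ζ - 1‖ < ε → ∃ v ∈ equimodularBall c p,
      inner ℂ (∑ j, α j • p j) v =
        inner ℂ (∑ j, α j • p j) w + (ζ - 1) * inner ℂ (α k • p k) w := by
  classical
  obtain ⟨q, hqE, hq⟩ := exists_biorthogonal hp
  obtain ⟨ε, hε, hv⟩ := exists_rotation_mem_equimodularBall (hqE k) (by rw [hq, if_pos rfl])
    (fun j hj => by rw [hq, if_neg hj]) hw
  refine ⟨ε, hε, fun ζ hζ hζ₁ => ⟨_, hv ζ hζ hζ₁, ?_⟩⟩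
  have hcoord : inner ℂ (∑ j, α j • p j) (q k) = star (α k) := by
    simp only [sum_inner, inner_smul_left, hq, mul_ite, mul_one, mul_zero, Finset.sum_ite_eq',
      Finset.mem_univ, if_true, Complex.star_def]
  rw [inner_add_right, inner_smul_right, hcoord, inner_smul_left, Complex.star_def]
  ring

theorem exists_coeff_eq_zero_of_norm_inner_eq [Fintype ι] [Nontrivial ι]
    (hp : LinearIndependent ℂ p) (hc : 0 < c) (hB : (equimodularBall c p).Nonempty) {α : ι → ℂ}
    (h : ∀ v ∈ equimodularBall c p, ‖inner ℂ (∑ k, α k • p k) v‖ = c) : ∃ k, α k = 0 := by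
  by_contra! hα
  obtain ⟨w, hw⟩ := hB
  set u := ∑ k, α k • p k
  have hne (k : ι) : inner ℂ (α k • p k) w ≠ 0 := by
    rw [inner_smul_left, mul_ne_zero_iff, ← norm_ne_zero_iff (a := inner ℂ (p k) w), hw.2.2]
    exact ⟨(map_ne_zero _).mpr (hα k), hc.ne'⟩
  have hcoord (k : ι) : inner ℂ u w = inner ℂ (α k • p k) w := by
    obtain ⟨ε, hε, hrot⟩ := exists_inner_rotation_mem_equimodularBall hp hw α k
    have hval {ζ : ℂ} (hζ : ‖ζ‖ = 1 ∧ ‖ζ - 1‖ < ε) :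
        ‖(inner ℂ u w - inner ℂ (α k • p k) w) + ζ * inner ℂ (α k • p k) w‖ = c := by
      obtain ⟨v, hv, hinner⟩ := hrot ζ hζ.1 hζ.2
      rw [← h v hv, hinner]
      congr 1
      ring
    obtain ⟨z₁, z₂, z₃, h₁, h₂, h₃, h₁₂, h₁₃, h₂₃⟩ :=
      two_lt_encard_iff.mp (two_lt_encard_of_infinite (infinite_unimodular_near_one hε))
    exact sub_eq_zero.mp <| (eq_zero_or_eq_zero_of_norm_add_mul h₁.1 h₂.1 h₃.1 h₁₂ h₁₃ h₂₃
      (hval h₁) (hval h₂) (hval h₃)).resolve_right (hne k)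
  have hsum : inner ℂ u w = Fintype.card ι * inner ℂ u w := by
    conv_lhs => rw [sum_inner, Finset.sum_congr rfl fun k _ => (hcoord k).symm, Finset.sum_const,
      Finset.card_univ, nsmul_eq_mul]
  obtain ⟨k⟩ := (inferInstance : Nonempty ι)
  have hcard := (right_eq_mul₀ (hcoord k ▸ hne k)).mp hsum
  exact Fintype.one_lt_card.ne' (by exact_mod_cast hcard)

theorem coeff_eq_zero_of_inner_eq_zero [Fintype ι] (hp : LinearIndependent ℂ p) (hc : 0 < c)
    (hB : (equimodularBall c p).Nonempty) {α : ι → ℂ}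
    (h : ∀ v ∈ equimodularBall c p, inner ℂ (∑ k, α k • p k) v = 0) (k : ι) : α k = 0 := by
  obtain ⟨w, hw⟩ := hB
  obtain ⟨ε, hε, hrot⟩ := exists_inner_rotation_mem_equimodularBall hp hw α k
  obtain ⟨ζ, ⟨hζ, hζε⟩, hζ₁⟩ := (infinite_unimodular_near_one hε).exists_notMem_finset {1}
  obtain ⟨v, hv, hinner⟩ := hrot ζ hζ hζε
  have hwk : inner ℂ (p k) w ≠ 0 := norm_ne_zero_iff.mp (hw.2.2 k ▸ hc.ne')
  rw [h v hv, h w hw, zero_add, inner_smul_left, eq_comm, mul_eq_zero_iff_left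
    (sub_ne_zero.mpr (mt Finset.mem_singleton.mpr hζ₁)), mul_eq_zero_iff_right hwk] at hinner
  exact (map_eq_zero _).mp hinner

theorem norm_sq_add_of_mem_orthogonal {E : Submodule ℂ H} {v y : H} (hv : v ∈ E) (hy : y ∈ Eᗮ) :
    ‖v + y‖ ^ 2 = ‖v‖ ^ 2 + ‖y‖ ^ 2 := by
  simpa only [sq] using norm_add_sq_eq_norm_sq_add_norm_sq_of_inner_eq_zero (𝕜 := ℂ) v y (hy v hv)

theorem exists_unit_lift_of_mem_equimodularBall {v y : H} (hv : v ∈ equimodularBall c p)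
    (hy : y ∈ (Submodule.span ℂ (Set.range p))ᗮ) (hy₀ : y ≠ 0) :
    ∃ s : ℝ, 0 < s ∧ ∀ z : ℂ, ‖z‖ = 1 →
      ‖v + (z * s) • y‖ = 1 ∧ ∀ j, ‖inner ℂ (p j) (v + (z * s) • y)‖ = c := by
  obtain ⟨hvE, hv₁, hvc⟩ := hv
  have hpos : 0 < 1 - ‖v‖ ^ 2 := by nlinarith [norm_nonneg v]
  have hy₀' : 0 < ‖y‖ := norm_pos_iff.mpr hy₀
  refine ⟨√(1 - ‖v‖ ^ 2) / ‖y‖, by positivity, fun z hz => ?_⟩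
  have hzy : (z * (√(1 - ‖v‖ ^ 2) / ‖y‖ : ℝ)) • y ∈ _ := Submodule.smul_mem _ _ hy
  constructor
  · rw [← sq_eq_sq₀ (norm_nonneg _) zero_le_one, norm_sq_add_of_mem_orthogonal hvE hzy, norm_smul,
      norm_mul, hz, one_mul, Complex.norm_real, Real.norm_of_nonneg (by positivity),
      div_mul_cancel₀ _ hy₀'.ne', Real.sq_sqrt hpos.le]
    ring
  · intro j
    rw [inner_add_right, hzy _ (Submodule.subset_span ⟨j, rfl⟩), add_zero, hvc]

theorem orthogonalProjection_mem_equimodularBall {w₁ w₂ : H}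
    (hw₁ : w₁ ∈ Submodule.span ℂ (Set.range p)) (hw₂ : w₂ ∈ (Submodule.span ℂ (Set.range p))ᗮ)
    (hw₂₀ : w₂ ≠ 0) (hw : ‖w₁ + w₂‖ = 1) (h : ∀ j, ‖inner ℂ (p j) (w₁ + w₂)‖ = c) :
    w₁ ∈ equimodularBall c p := by
  have hnorm := norm_sq_add_of_mem_orthogonal hw₁ hw₂
  rw [hw] at hnorm
  refine ⟨hw₁, by nlinarith [norm_nonneg w₁, norm_pos_iff.mpr hw₂₀], fun j => ?_⟩
  rw [← h, inner_add_right, hw₂ _ (Submodule.subset_span ⟨j, rfl⟩), add_zero]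

variable [Fintype ι] [Nontrivial ι]

theorem mem_orthogonal_of_norm_inner_eq (hp : LinearIndependent ℂ p) (hc : 0 < c)
    (hB : (equimodularBall c p).Nonempty) {y : H} (hy : y ∈ (Submodule.span ℂ (Set.range p))ᗮ)
    (hy₀ : y ≠ 0) {u : H} (hu : ∀ α : ι → ℂ, ∑ k, α k • p k = u → ∀ k, α k ≠ 0)
    (h : ∀ v : H, ‖v‖ = 1 → (∀ j, ‖inner ℂ (p j) v‖ = c) → ‖inner ℂ u v‖ = c) :
    u ∈ (Submodule.span ℂ (Set.range p))ᗮ := by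
  have := FiniteDimensional.span_of_finite ℂ (Set.finite_range p)
  obtain ⟨u₁, hu₁, u₂, hu₂, rfl⟩ :=
    (Submodule.span ℂ (Set.range p)).exists_add_mem_mem_orthogonal u
  obtain ⟨α, rfl⟩ := (Submodule.mem_span_range_iff_exists_fun ℂ).mp hu₁
  have hlift {v y : H} (hv : v ∈ equimodularBall c p)
      (hy : y ∈ (Submodule.span ℂ (Set.range p))ᗮ) (hy₀ : y ≠ 0) :
      ∃ s : ℝ, 0 < s ∧ ∀ z : ℂ, ‖z‖ = 1 →
        ‖inner ℂ (∑ k, α k • p k) v + z * (s * inner ℂ u₂ y)‖ = c := by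
    obtain ⟨s, hs, hsv⟩ := exists_unit_lift_of_mem_equimodularBall hv hy hy₀
    refine ⟨s, hs, fun z hz => ?_⟩
    rw [← h _ (hsv z hz).1 (hsv z hz).2, inner_add_left, inner_add_right, inner_add_right,
      Submodule.smul_mem _ (z * s) hy _ hu₁, inner_eq_zero_symm.mp (hu₂ v hv.1), inner_smul_right,
      add_zero, zero_add, mul_assoc]
  rcases eq_or_ne u₂ 0 with rfl | hu₂₀
  · obtain ⟨k, hk⟩ := exists_coeff_eq_zero_of_norm_inner_eq hp hc hB fun v hv => by
      obtain ⟨s, -, hs⟩ := hlift hv hy hy₀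
      simpa only [inner_zero_left, mul_zero, add_zero] using hs 1 norm_one
    exact absurd hk (hu α (add_zero _).symm k)
  · have hinner (v : H) (hv : v ∈ equimodularBall c p) : inner ℂ (∑ k, α k • p k) v = 0 := by
      obtain ⟨s, hs₀, hs⟩ := hlift hv hu₂ hu₂₀
      obtain ⟨z₁, z₂, z₃, h₁, h₂, h₃, h₁₂, h₁₃, h₂₃⟩ :=
        two_lt_encard_iff.mp (two_lt_encard_of_infinite infinite_unimodular)
      exact (eq_zero_or_eq_zero_of_norm_add_mul h₁ h₂ h₃ h₁₂ h₁₃ h₂₃ (hs _ h₁) (hs _ h₂)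
        (hs _ h₃)).resolve_right
        (mul_ne_zero (Complex.ofReal_ne_zero.mpr hs₀.ne') (inner_self_ne_zero.mpr hu₂₀))
    simpa only [coeff_eq_zero_of_inner_eq_zero hp hc hB hinner, zero_smul, Finset.sum_const_zero,
      zero_add] using hu₂

theorem mem_span_range_of_forall_norm_inner_eq (hp : LinearIndependent ℂ p) (hc : 0 < c) {w : H}
    (hw : ‖w‖ = 1) (hpw : ∀ j, ‖inner ℂ (p j) w‖ = c) {x x' : H} (hx : ‖x‖ = 1)
    (hxx' : ∀ z : ℂ, z • x ≠ x') (hxp : ∀ α : ι → ℂ, ∑ k, α k • p k = x → ∀ k, α k ≠ 0)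
    (hxp' : ∀ α : ι → ℂ, ∑ k, α k • p k = x' → ∀ k, α k ≠ 0)
    (h : ∀ v : H, ‖v‖ = 1 → (∀ j, ‖inner ℂ (p j) v‖ = c) →
      ‖inner ℂ x v‖ = c ∧ ‖inner ℂ x' v‖ = c) :
    w ∈ Submodule.span ℂ (Set.range p) := by
  have := FiniteDimensional.span_of_finite ℂ (Set.finite_range p)
  obtain ⟨w₁, hw₁, w₂, hw₂, rfl⟩ :=
    (Submodule.span ℂ (Set.range p)).exists_add_mem_mem_orthogonal w
  rcases eq_or_ne w₂ 0 with rfl | hw₂₀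
  · rwa [add_zero]
  have hB := orthogonalProjection_mem_equimodularBall hw₁ hw₂ hw₂₀ hw hpw
  have hxE := mem_orthogonal_of_norm_inner_eq hp hc ⟨_, hB⟩ hw₂ hw₂₀ hxp fun v hv hpv =>
    (h v hv hpv).1
  have hxE' := mem_orthogonal_of_norm_inner_eq hp hc ⟨_, hB⟩ hw₂ hw₂₀ hxp' fun v hv hpv =>
    (h v hv hpv).2
  obtain ⟨s, -, hs⟩ := exists_unit_lift_of_mem_equimodularBall hB
    (sub_mem hxE' (Submodule.smul_mem _ (inner ℂ x x') hxE))
    (sub_ne_zero.mpr (hxx' _).symm)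
  have hcontra := (h _ (hs 1 norm_one).1 (hs 1 norm_one).2).1
  rw [inner_add_right, inner_eq_zero_symm.mp (hxE _ hw₁), inner_smul_right, inner_sub_right,
    inner_smul_right, inner_self_eq_one_of_norm_eq_one hx, mul_one, sub_self, mul_zero, add_zero,
    norm_zero] at hcontra
  exact absurd hcontra hc.ne

end EquimodularVectors

section Planes

variable {H : Type*} [NormedAddCommGroup H] [InnerProductSpace ℂ H] {c : ℝ}
  {p q r s s' w x x' y : ℙ ℂ H}

theorem submodule_le_sup_exchange {K : Submodule ℂ H} (h : x.submodule ≤ K ⊔ y.submodule)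
    (hx : ¬x.submodule ≤ K) : y.submodule ≤ K ⊔ x.submodule := by
  induction x with | h u hu =>
  induction y with | h v hv =>
  simp only [Projectivization.submodule_mk, Submodule.span_singleton_le_iff_mem] at h hx ⊢
  rw [sup_comm, ← Submodule.span_eq K, ← Submodule.span_insert] at h ⊢
  exact mem_span_insert_exchange h (by rwa [Submodule.span_eq])

theorem submodule_mk_le_sup_iff {u v w t : H} {hu : u ≠ 0} {hv : v ≠ 0} {hw : w ≠ 0}
    {ht : t ≠ 0} :
    (Projectivization.mk ℂ t ht).submodule ≤ (Projectivization.mk ℂ u hu).submodule ⊔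
        (Projectivization.mk ℂ v hv).submodule ⊔ (Projectivization.mk ℂ w hw).submodule ↔
      ∃ a b d : ℂ, a • u + b • v + d • w = t := by
  simp only [Projectivization.submodule_mk]
  rw [Submodule.span_singleton_le_iff_mem, sup_assoc, ← Submodule.span_insert,
    ← Submodule.span_insert, Submodule.mem_span_triple]

theorem finrank_sup_submodule_le (p q r : ℙ ℂ H) :
    Module.finrank ℂ ↥(p.submodule ⊔ q.submodule ⊔ r.submodule) ≤ 3 := by
  have h := Submodule.finrank_add_le_finrank_add_finrank (p.submodule ⊔ q.submodule) r.submodule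
  have h' := finrank_submodule_sup_submodule_le p q
  rw [r.finrank_submodule] at h
  omega

theorem linearIndependent_of_not_onLine {u v w : H} {hu : u ≠ 0} {hv : v ≠ 0} {hw : w ≠ 0}
    (hvw : Projectivization.mk ℂ v hv ≠ Projectivization.mk ℂ w hw)
    (h : ¬OnLine (Projectivization.mk ℂ v hv) (Projectivization.mk ℂ w hw)
      (Projectivization.mk ℂ u hu)) : LinearIndependent ℂ ![u, v, w] := by
  refine linearIndependent_finCons.mpr ⟨(LinearIndependent.pair_iff' hv).mpr fun a ha => ?_, ?_⟩
  · exact hvw ((Projectivization.mk_eq_mk_iff' ℂ _ _ _ _).mpr ⟨a, ha⟩).symm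
  · rwa [Matrix.range_cons_cons_empty, Submodule.mem_span_pair, ← onLine_mk_iff]

theorem submodule_le_sup_of_mem_equiangular (hc : 0 < c) (hqr : q ≠ r) (hp : ¬OnLine q r p)
    (hx₁ : ¬OnLine q r x) (hx₂ : ¬OnLine p r x) (hx₃ : ¬OnLine p q x)
    (hx₁' : ¬OnLine q r x') (hx₂' : ¬OnLine p r x') (hx₃' : ¬OnLine p q x') (hxx' : x ≠ x')
    (h : equiangular c {p, q, r} ⊆ equiangular c {x, x'}) (hw : w ∈ equiangular c {p, q, r}) :
    w.submodule ≤ p.submodule ⊔ q.submodule ⊔ r.submodule := by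
  obtain ⟨u₁, h₁, rfl⟩ := exists_ray p
  obtain ⟨u₂, h₂, rfl⟩ := exists_ray q
  obtain ⟨u₃, h₃, rfl⟩ := exists_ray r
  obtain ⟨v, hv, rfl⟩ := exists_ray x
  obtain ⟨v', hv', rfl⟩ := exists_ray x'
  obtain ⟨t, ht, rfl⟩ := exists_ray w
  have hmem {v : H} (hv : ‖v‖ = 1) : ray v hv ∈ equiangular c {ray u₁ h₁, ray u₂ h₂, ray u₃ h₃} ↔
      ∀ j, ‖inner ℂ (![u₁, u₂, u₃] j) v‖ = c := by
    simp [equiangular, overlap_ray, Fin.forall_fin_succ]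
  have hcoeff {v : H} (hv : ‖v‖ = 1) (n₁ : ¬OnLine (ray u₂ h₂) (ray u₃ h₃) (ray v hv))
      (n₂ : ¬OnLine (ray u₁ h₁) (ray u₃ h₃) (ray v hv))
      (n₃ : ¬OnLine (ray u₁ h₁) (ray u₂ h₂) (ray v hv)) (α : Fin 3 → ℂ)
      (hα : ∑ k, α k • ![u₁, u₂, u₃] k = v) (k : Fin 3) : α k ≠ 0 := by
    have hα' : α 0 • u₁ + α 1 • u₂ + α 2 • u₃ = v := by rw [← hα, Fin.sum_univ_three]; rfl
    intro hk
    fin_cases k <;> simp only [Fin.reduceFinMk, Fin.zero_eta, Fin.mk_one] at hk <;>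
      rw [hk, zero_smul] at hα'
    · exact n₁ (onLine_mk_iff.mpr ⟨α 1, α 2, by rw [← hα', zero_add]⟩)
    · exact n₂ (onLine_mk_iff.mpr ⟨α 0, α 2, by rw [← hα', add_zero]⟩)
    · exact n₃ (onLine_mk_iff.mpr ⟨α 0, α 1, by rw [← hα', add_zero]⟩)
  have hspan := mem_span_range_of_forall_norm_inner_eq (linearIndependent_of_not_onLine hqr hp) hc
    ht ((hmem ht).mp hw) hv (fun z hz => hxx' (ray_eq_ray_iff.mpr ⟨z, hz⟩).symm)
    (hcoeff hv hx₁ hx₂ hx₃) (hcoeff hv' hx₁' hx₂' hx₃') fun y hy hpy => by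
      have hy' := h ((hmem hy).mpr hpy)
      rw [← overlap_ray hv hy, ← overlap_ray hv' hy]
      exact ⟨hy' _ (.inl rfl), hy' _ (.inr rfl)⟩
  obtain ⟨α, hα⟩ := (Submodule.mem_span_range_iff_exists_fun ℂ).mp hspan
  refine submodule_mk_le_sup_iff.mpr ⟨α 0, α 1, α 2, ?_⟩
  rw [← hα, Fin.sum_univ_three]
  rfl

theorem mem_span_pair_of_mul_eq_mul {u v w : H} {a b d a' b' d' : ℂ} (hd : d ≠ 0)
    (h : a * d' = a' * d) :
    a' • u + b' • v + d' • w ∈ Submodule.span ℂ {a • u + b • v + d • w, v} := by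
  obtain ⟨e, rfl⟩ : ∃ e, d' = e * d := ⟨d' / d, (div_mul_cancel₀ _ hd).symm⟩
  obtain rfl : a' = e * a := mul_right_cancel₀ hd (by linear_combination -h)
  exact Submodule.mem_span_pair.mpr ⟨e, b' - e * b, by module⟩

theorem norm_add_div_mul_eq_one {w u₁ u₂ u₃ : H} (hc : 0 < c) (hw : ‖inner ℂ w u₁‖ = c)
    {a b d : ℂ} (h : ‖inner ℂ w (a • u₁ + b • u₂ + d • u₃)‖ = c) :
    ‖a + b * (inner ℂ w u₂ / inner ℂ w u₁) + d * (inner ℂ w u₃ / inner ℂ w u₁)‖ = 1 := by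
  have hw₀ : inner ℂ w u₁ ≠ 0 := norm_pos_iff.mp (by rwa [hw])
  rw [inner_add_right, inner_add_right, inner_smul_right, inner_smul_right, inner_smul_right] at h
  refine mul_right_cancel₀ hc.ne' ?_
  rw [one_mul]
  nth_rw 1 [← hw]
  rw [← h, ← norm_mul]
  congr 1
  field_simp

theorem OnLine.eq_of_overlap_eq_zero_of_ne_zero (hx : OnLine p q x) (hy : OnLine p q y)
    (hxw : overlap x w = 0) (hyw : overlap y w = 0) (hpw : overlap p w ≠ 0) : x = y :=
  by_contra fun hxy => hpw ((hx.exchange hy hxy (onLine_left p q)).overlap_eq_zero hxw hyw)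

theorem finite_setOf_onLine_ray_overlap_eq_zero {u₁ u₂ u₃ : H} {h₁ : ‖u₁‖ = 1} {h₂ : ‖u₂‖ = 1}
    {h₃ : ‖u₃‖ = 1} {x y z x' y' z' : ℂ} {hv : ‖x • u₁ + y • u₂ + z • u₃‖ = 1}
    {hv' : ‖x' • u₁ + y' • u₂ + z' • u₃‖ = 1} (hc : 0 < c) (hpq : ray u₁ h₁ ≠ ray u₂ h₂)
    (hx : x ≠ 0) (hy : y ≠ 0) (hx' : x' ≠ 0) (hy' : y' ≠ 0) (hxz : x * z' - x' * z ≠ 0)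
    (hyz : y * z' - y' * z ≠ 0) :
    {t | OnLine (ray u₁ h₁) (ray u₂ h₂) t ∧
      ∃ w ∈ equiangular c {ray u₁ h₁, ray u₂ h₂, ray u₃ h₃, ray _ hv, ray _ hv'},
        overlap t w = 0}.Finite := by
  have hne (a : ℂ) : u₂ - a • u₁ ≠ 0 := fun h =>
    hpq (ray_eq_ray_iff.mpr ⟨a, (sub_eq_zero.mp h).symm⟩).symm
  refine ((finite_setOf_two_unimodular_equations hx hy hx' hy' hxz hyz).image
    fun a => Projectivization.mk ℂ (u₂ - a • u₁) (hne a)).subset ?_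
  rintro t ⟨hpqt, w, hw, htw⟩
  obtain ⟨w, hw₀, rfl⟩ := exists_ray w
  have hnorm {v : H} {hv : ‖v‖ = 1} (h : overlap (ray v hv) (ray w hw₀) = c) :
      ‖inner ℂ w v‖ = c := by
    rwa [overlap_ray, norm_inner_symm] at h
  simp only [equiangular, Set.mem_ofPred_eq, Set.forall_mem_insert, Set.mem_singleton_iff,
    forall_eq] at hw
  obtain ⟨hw₁, hw₂, hw₃, hws, hws'⟩ := hw
  have hw₁' : inner ℂ w u₁ ≠ 0 := norm_pos_iff.mp (by rwa [hnorm hw₁])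
  refine ⟨inner ℂ w u₂ / inner ℂ w u₁, ⟨?_, inner ℂ w u₃ / inner ℂ w u₁, ?_,
    norm_add_div_mul_eq_one hc (hnorm hw₁) (hnorm hws),
    norm_add_div_mul_eq_one hc (hnorm hw₁) (hnorm hws')⟩, ?_⟩
  · rw [norm_div, hnorm hw₁, hnorm hw₂, div_self hc.ne']
  · rw [norm_div, hnorm hw₁, hnorm hw₃, div_self hc.ne']
  · refine OnLine.eq_of_overlap_eq_zero_of_ne_zero
      (onLine_mk_iff.mpr ⟨-(inner ℂ w u₂ / inner ℂ w u₁), 1, by module⟩) hpqt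
      (overlap_mk_eq_zero_iff.mpr (inner_eq_zero_symm.mp ?_)) htw (hw₁.trans_ne hc.ne')
    rw [inner_sub_right, inner_smul_right, div_mul_cancel₀ _ hw₁', sub_self]

theorem finite_setOf_onLine_overlap_eq_zero (hc : 0 < c) (hpq : p ≠ q)
    (hs : s.submodule ≤ p.submodule ⊔ q.submodule ⊔ r.submodule)
    (hs' : s'.submodule ≤ p.submodule ⊔ q.submodule ⊔ r.submodule)
    (hs₁ : ¬OnLine q r s) (hs₂ : ¬OnLine p r s) (hs₃ : ¬OnLine p q s)
    (hs₁' : ¬OnLine q r s') (hs₂' : ¬OnLine p r s') (hs₃' : ¬OnLine s p s')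
    (hs₄' : ¬OnLine s q s') :
    {v | OnLine p q v ∧ ∃ w ∈ equiangular c {p, q, r, s, s'}, overlap v w = 0}.Finite := by
  obtain ⟨u₁, h₁, rfl⟩ := exists_ray p
  obtain ⟨u₂, h₂, rfl⟩ := exists_ray q
  obtain ⟨u₃, h₃, rfl⟩ := exists_ray r
  obtain ⟨v, hv, rfl⟩ := exists_ray s
  obtain ⟨v', hv', rfl⟩ := exists_ray s'
  obtain ⟨x, y, z, rfl⟩ := submodule_mk_le_sup_iff.mp hs
  obtain ⟨x', y', z', rfl⟩ := submodule_mk_le_sup_iff.mp hs'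
  simp only [ray, onLine_mk_iff] at hs₁ hs₂ hs₃ hs₁' hs₂' hs₃' hs₄'
  have hx : x ≠ 0 := fun h => hs₁ ⟨y, z, by rw [h]; module⟩
  have hy : y ≠ 0 := fun h => hs₂ ⟨x, z, by rw [h]; module⟩
  have hz : z ≠ 0 := fun h => hs₃ ⟨x, y, by rw [h]; module⟩
  have hx' : x' ≠ 0 := fun h => hs₁' ⟨y', z', by rw [h]; module⟩
  have hy' : y' ≠ 0 := fun h => hs₂' ⟨x', z', by rw [h]; module⟩
  have hxz : x * z' - x' * z ≠ 0 := fun h =>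
    hs₄' (Submodule.mem_span_pair.mp (mem_span_pair_of_mul_eq_mul hz (sub_eq_zero.mp h)))
  have hyz : y * z' - y' * z ≠ 0 := fun h => hs₃' (Submodule.mem_span_pair.mp (by
    rw [add_comm (x • u₁), add_comm (x' • u₁)]
    exact mem_span_pair_of_mul_eq_mul hz (sub_eq_zero.mp h)))
  exact finite_setOf_onLine_ray_overlap_eq_zero hc hpq hx hy hx' hy' hxz hyz

end Planes

section CircleLikeSets

variable {H : Type*} [NormedAddCommGroup H] [InnerProductSpace ℂ H] {c : ℝ} {F G S : Set (ℙ ℂ H)}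
  {p q r w : ℙ ℂ H}

/-- The properties of a great circle on a projective line, expressed through the relation
`overlap p q = c` alone, which force a set of points to be contained in a projective line. -/
structure CircleLike (c : ℝ) (F : Set (ℙ ℂ H)) : Prop where
  infinite : F.Infinite
  infinite_equiangular : (equiangular c F).Infinite
  equiangular_subset : ∀ S ⊆ F, 2 < S.encard → equiangular c S ⊆ equiangular c F
  finite_diff : (equiangular c (equiangular c F) \ F).Finite

theorem CircleLike.infinite_inter (hF : CircleLike c F) (hG : G.Infinite)
    (h : G ⊆ equiangular c (equiangular c F)) : (F ∩ G).Infinite := by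
  refine fun hfin => hG ((hfin.union hF.finite_diff).subset fun p hp => ?_)
  by_cases hpF : p ∈ F
  · exact .inl ⟨hpF, hp⟩
  · exact .inr ⟨h hp, hpF⟩

/-- A set of points no three of which are collinear. -/
def IsCap (F : Set (ℙ ℂ H)) : Prop :=
  ∀ p ∈ F, ∀ q ∈ F, ∀ r ∈ F, p ≠ q → p ≠ r → q ≠ r → ¬OnLine p q r

theorem IsCap.finite_of_forall_onLine (hcap : IsCap F) (hSF : S ⊆ F)
    (hS : ∀ x ∈ S, ∀ y ∈ S, ∀ z ∈ S, x ≠ y → OnLine x y z) : S.Finite := by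
  by_contra hinf
  obtain ⟨x, y, z, hx, hy, hz, hxy, hxz, hyz⟩ :=
    two_lt_encard_iff.mp (two_lt_encard_of_infinite hinf)
  exact hcap x (hSF hx) y (hSF hy) z (hSF hz) hxy hxz hyz (hS x hx y hy z hz hxy)

theorem IsCap.submodule_le (hcap : IsCap F) (hc : 0 < c) (hF : CircleLike c F) (hp : p ∈ F)
    (hq : q ∈ F) (hr : r ∈ F) (hpq : p ≠ q) (hpr : p ≠ r) (hqr : q ≠ r)
    (hw : w ∈ equiangular c F) :
    w.submodule ≤ p.submodule ⊔ q.submodule ⊔ r.submodule := by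
  have hpqr : {p, q, r} ⊆ F := by
    rintro _ (rfl | rfl | rfl) <;> assumption
  obtain ⟨x, hx, hxn⟩ := hF.infinite.exists_notMem_finite (Set.toFinite {p, q, r})
  obtain ⟨x', hx', hxn'⟩ := hF.infinite.exists_notMem_finite (Set.toFinite {p, q, r, x})
  simp only [Set.mem_singleton_iff, Set.mem_insert_iff, not_or, ← ne_eq] at hxn hxn'
  obtain ⟨hxp, hxq, hxr⟩ := hxn
  obtain ⟨hxp', hxq', hxr', hxx'⟩ := hxn'
  have hcard : 2 < Set.encard {p, q, r} :=
    two_lt_encard_iff.mpr ⟨p, q, r, by simp, by simp, by simp, hpq, hpr, hqr⟩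
  refine submodule_le_sup_of_mem_equiangular hc hqr
    (hcap q hq r hr p hp hqr hpq.symm hpr.symm)
    (hcap q hq r hr x hx hqr hxq.symm hxr.symm) (hcap p hp r hr x hx hpr hxp.symm hxr.symm)
    (hcap p hp q hq x hx hpq hxp.symm hxq.symm)
    (hcap q hq r hr x' hx' hqr hxq'.symm hxr'.symm)
    (hcap p hp r hr x' hx' hpr hxp'.symm hxr'.symm)
    (hcap p hp q hq x' hx' hpq hxp'.symm hxq'.symm) hxx'.symm ?_ (equiangular_anti hpqr hw)
  refine (hF.equiangular_subset _ hpqr hcard).trans (equiangular_anti ?_)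
  rintro _ (rfl | rfl) <;> assumption

/- Otherwise the points of the cap could be rotated about the line `pq` without leaving
`equiangular c (equiangular c F)`, which would put a circle into the cap. -/
theorem IsCap.exists_not_onLine (hcap : IsCap F) (hc : 0 < c) (hF : CircleLike c F) (hp : p ∈ F)
    (hq : q ∈ F) (hpq : p ≠ q) : ∃ w ∈ equiangular c F, ¬OnLine p q w := by
  by_contra! honLine
  obtain ⟨r, hr, hrn⟩ := hF.infinite.exists_notMem_finite (Set.toFinite {p, q})
  simp only [Set.mem_singleton_iff, Set.mem_insert_iff, not_or, ← ne_eq] at hrn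
  have hpqr : ¬OnLine p q r := hcap p hp q hq r hr hpq hrn.1.symm hrn.2.symm
  obtain ⟨N, N', hN, hN', hNN', hN'r⟩ := exists_adapted_pair hpq r
  have hNr : N ≠ r := by
    rintro rfl
    exact hpqr hN
  obtain ⟨Y, hY, hYN⟩ := exists_onLine_overlap_eq_zero hNr N
  have hNY : overlap N Y = 0 := (overlap_comm _ _).trans hYN
  have hYN' : overlap Y N' = 0 :=
    hY.overlap_eq_zero hNN' ((overlap_comm _ _).trans hN'r)
  have hrY : r ∈ latitudeCircle (overlap N r) N Y :=
    ⟨(onLine_left N r).exchange hY (ne_of_overlap_eq_zero hNY) (onLine_right N r), rfl⟩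
  have hmul {t w : ℙ ℂ H} (ht : t ∈ latitudeCircle (overlap N r) N Y)
      (hw : w ∈ equiangular c F) : overlap t w = overlap N r * overlap N w := by
    refine overlap_eq_mul_of_mem_latitudeCircle hNY ht ?_
    rw [overlap_comm]
    exact (hN.exchange hN' (ne_of_overlap_eq_zero hNN') (honLine w hw)).overlap_eq_zero hNY
      ((overlap_comm _ _).trans hYN')
  obtain ⟨w, hw⟩ := hF.infinite_equiangular.nonempty
  have hk₀ : overlap N r ≠ 0 := fun h => hc.ne <| by
    rw [← hw r hr, hmul hrY hw, h, zero_mul]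
  have hk₁ : overlap N r ≠ 1 := fun h => hNr (overlap_eq_one_iff.mp h)
  refine hF.infinite_inter (infinite_latitudeCircle hNY ((overlap_nonneg _ _).lt_of_ne hk₀.symm)
    ((overlap_le_one _ _).lt_of_ne hk₁)) (fun t ht w hw => ?_)
    (hcap.finite_of_forall_onLine Set.inter_subset_left
      fun x hx y hy z hz hxy => hx.2.1.exchange hy.2.1 hxy hz.2.1)
  rw [overlap_comm, hmul ht hw, ← hmul hrY hw, hw r hr]

theorem IsCap.exists_infinite_overlap_eq_zero (hcap : IsCap F) (hc : 0 < c) (hF : CircleLike c F)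
    (hp : p ∈ F) (hq : q ∈ F) (hr : r ∈ F) (hpq : p ≠ q) (hpr : p ≠ r) (hqr : q ≠ r)
    (hFE : ∀ x ∈ F, x.submodule ≤ p.submodule ⊔ q.submodule ⊔ r.submodule) :
    ∃ v, OnLine p q v ∧ {w ∈ equiangular c F | overlap v w = 0}.Infinite := by
  obtain ⟨s, hs, hsn⟩ := hF.infinite.exists_notMem_finite (Set.toFinite {p, q, r})
  obtain ⟨s', hs', hsn'⟩ := hF.infinite.exists_notMem_finite (Set.toFinite {p, q, r, s})
  simp only [Set.mem_singleton_iff, Set.mem_insert_iff, not_or, ← ne_eq] at hsn hsn'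
  obtain ⟨hsp, hsq, hsr⟩ := hsn
  obtain ⟨hsp', hsq', hsr', hss'⟩ := hsn'
  have hfin := finite_setOf_onLine_overlap_eq_zero hc hpq (hFE s hs) (hFE s' hs')
    (hcap q hq r hr s hs hqr hsq.symm hsr.symm) (hcap p hp r hr s hs hpr hsp.symm hsr.symm)
    (hcap p hp q hq s hs hpq hsp.symm hsq.symm)
    (hcap q hq r hr s' hs' hqr hsq'.symm hsr'.symm)
    (hcap p hp r hr s' hs' hpr hsp'.symm hsr'.symm)
    (hcap s hs p hp s' hs' hsp hss'.symm hsp'.symm)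
    (hcap s hs q hq s' hs' hsq hss'.symm hsq'.symm)
  by_contra! hcon
  refine hF.infinite_equiangular ((hfin.biUnion fun v hv => hcon v hv.1).subset fun w hw => ?_)
  obtain ⟨v, hv, hvw⟩ := exists_onLine_overlap_eq_zero hpq w
  refine Set.mem_biUnion ⟨hv, w, equiangular_anti ?_ hw, hvw⟩ ⟨hw, hvw⟩
  rintro _ (rfl | rfl | rfl | rfl | rfl) <;> assumption

theorem CircleLike.not_isCap (hF : CircleLike c F) (hc : 0 < c) : ¬IsCap F := by
  intro hcap
  obtain ⟨p, q, r, hp, hq, hr, hpq, hpr, hqr⟩ :=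
    two_lt_encard_iff.mp (two_lt_encard_of_infinite hF.infinite)
  let E := p.submodule ⊔ q.submodule ⊔ r.submodule
  have hEcap {w} (hw : w ∈ equiangular c F) : w.submodule ≤ E :=
    hcap.submodule_le hc hF hp hq hr hpq hpr hqr hw
  have hFE : ∀ x ∈ F, x.submodule ≤ E := fun x hx => by
    by_cases hpqx : OnLine p q x
    · exact hpqx.trans le_sup_left
    obtain ⟨b, hb, hpqb⟩ := hcap.exists_not_onLine hc hF hp hq hpq
    have hpx : p ≠ x := by rintro rfl; exact hpqx (onLine_left p q)
    have hqx : q ≠ x := by rintro rfl; exact hpqx (onLine_right p q)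
    exact (submodule_le_sup_exchange (hcap.submodule_le hc hF hp hq hx hpq hpx hqx hb) hpqb).trans
      (sup_le le_sup_left (hEcap hb))
  obtain ⟨v, hv, hinf⟩ :=
    hcap.exists_infinite_overlap_eq_zero hc hF hp hq hr hpq hpr hqr hFE
  have hcard := two_lt_encard_of_infinite hinf
  obtain ⟨b₁, b₂, -, hb₁, hb₂, -, hb₁₂, -, -⟩ := two_lt_encard_iff.mp hcard
  have hdual {x} (hx : x ∈ F) : x ∈ equiangular c {w ∈ equiangular c F | overlap v w = 0} :=
    fun w hw => (overlap_comm _ _).trans (hw.1 x hx)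
  obtain ⟨N, N', hN, hN', hNN', -, hNp, hcircle⟩ := exists_poles hb₁₂
    (fun s hs => onLine_of_overlap_eq_zero (finrank_sup_submodule_le p q r) (hv.trans le_sup_left)
      (hEcap hb₁.1) (hEcap hb₂.1) (hEcap hs.1) hb₁.2 hb₂.2 hs.2 hb₁₂) ⟨b₁, hb₁⟩ hc (hdual hp)
  have hfin {M : ℙ ℂ H} (hM : OnLine b₁ b₂ M) : {x ∈ F | overlap M x = 0}.Finite :=
    hcap.finite_of_forall_onLine (fun x hx => hx.1) fun x hx y hy z hz hxy =>
      onLine_of_overlap_eq_zero (finrank_sup_submodule_le p q r)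
        (hM.trans (sup_le (hEcap hb₁.1) (hEcap hb₂.1))) (hFE x hx.1) (hFE y hy.1) (hFE z hz.1)
        hx.2 hy.2 hz.2 hxy
  refine hF.infinite (((hfin hN).union (hfin hN')).subset fun x hx => ?_)
  exact (overlap_eq_zero_or_of_mem_equiangular hNN' (div_pos hc hNp) hcircle hcard
    (hdual hx)).imp (⟨hx, ·⟩) (⟨hx, ·⟩)

end CircleLikeSets

section CollinearityOfCircleLikeSets

variable {H : Type*} [NormedAddCommGroup H] [InnerProductSpace ℂ H] {c k r t σ : ℝ}
  {F S : Set (ℙ ℂ H)} {p q N N' M Y x : ℙ ℂ H}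

theorem exists_mem_latitudeCircle_forall_overlap_eq_mem (h : overlap N N' = 0) (hk₀ : 0 < k)
    (hk₁ : k < 1) (hσ₀ : 0 < σ) (hσ₁ : σ < 1) (t : ℝ) (hF : (latitudeCircle k N N' \ F).Finite) :
    ∃ M ∈ latitudeCircle σ N N', ∀ p ∈ latitudeCircle k N N', overlap p M = t → p ∈ F := by
  by_contra! hcon
  have hfin {p : ℙ ℂ H} (hp : p ∈ latitudeCircle k N N') :
      {M ∈ latitudeCircle σ N N' | overlap p M = t}.Finite := by
    by_contra hinf
    have hpole := overlap_eq_zero_or_of_mem_equiangular h hσ₀ (fun M hM => hM.1)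
      (two_lt_encard_of_infinite hinf) fun M hM => (overlap_comm M p).trans hM.2
    rw [hp.2, overlap_right_of_mem_latitudeCircle h hp] at hpole
    exact hpole.elim hk₀.ne' (Real.sqrt_pos.mpr (by nlinarith)).ne'
  refine infinite_latitudeCircle h hσ₀ hσ₁
    ((hF.biUnion fun p hp => hfin hp.1).subset fun M hM => ?_)
  obtain ⟨p, hp, hpM, hpF⟩ := hcon M hM
  exact Set.mem_biUnion ⟨hp, hpF⟩ ⟨hM, hpM⟩

theorem exists_two_mem_latitudeCircle_overlap_eq_self (h : overlap N N' = 0) (hk₀ : 0 < k)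
    (hk₁ : k < 1) (hM : M ∈ latitudeCircle √(1 - (k * √(1 - k ^ 2)) ^ 2) N N') :
    ∃ p ∈ latitudeCircle k N N', ∃ q ∈ latitudeCircle k N N', p ≠ q ∧ overlap p M = k ∧
      overlap q M = k := by
  have hτ₀ : 0 < √(1 - k ^ 2) := Real.sqrt_pos.mpr (by nlinarith)
  have hτ₁ : √(1 - k ^ 2) ^ 2 = 1 - k ^ 2 := Real.sq_sqrt (by nlinarith)
  have hN'M := overlap_right_of_mem_latitudeCircle h hM
  rw [Real.sq_sqrt (by nlinarith), sub_sub_cancel, Real.sqrt_sq (by positivity)] at hN'M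
  have hσ : k ^ 2 < √(1 - (k * √(1 - k ^ 2)) ^ 2) :=
    Real.lt_sqrt_of_sq_lt (by nlinarith)
  have hσ₁ : √(1 - (k * √(1 - k ^ 2)) ^ 2) ≤ 1 := hM.2 ▸ overlap_le_one N M
  refine exists_two_mem_latitudeCircle_overlap_eq h hk₀ hk₁ ?_ ?_ <;> rw [hM.2, hN'M]
  · rw [abs_lt]
    constructor <;> nlinarith
  · nlinarith

theorem exists_mem_latitudeCircle_overlap_eq (h : overlap N N' = 0) (hk₀ : 0 < k) (hk₁ : k < 1)
    (hc : √(1 - k ^ 2) * overlap N' x = c) (hx : k * overlap N x < 2 * c) :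
    ∃ p ∈ latitudeCircle k N N', overlap p x = c := by
  rcases (overlap_nonneg N x).eq_or_lt with hx₀ | hx₀
  · obtain ⟨p, hp⟩ := (infinite_latitudeCircle h hk₀ hk₁).nonempty
    exact ⟨p, hp, (overlap_eq_sqrt_mul_of_mem_latitudeCircle h hp hx₀.symm).trans hc⟩
  · have := mul_pos hk₀ hx₀
    obtain ⟨p, hp, -, -, -, hpx, -⟩ := exists_two_mem_latitudeCircle_overlap_eq (t := c) h hk₀ hk₁
      (by rw [hc, abs_lt]; constructor <;> linarith) (by linarith)
    exact ⟨p, hp, hpx⟩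

theorem exists_onLine_two_mem_overlap_eq (h : overlap N N' = 0) (hk₀ : 0 < k) (hk₁ : k < 1)
    (hF : (latitudeCircle k N N' \ F).Finite) :
    ∃ M, OnLine N N' M ∧ 0 < overlap N M ∧ overlap N' M = k * √(1 - k ^ 2) ∧
      ∃ p ∈ F ∩ latitudeCircle k N N', ∃ q ∈ F ∩ latitudeCircle k N N', p ≠ q ∧
        overlap p M = k ∧ overlap q M = k := by
  have hτ₀ : 0 < √(1 - k ^ 2) := Real.sqrt_pos.mpr (by nlinarith)
  have hτ₁ : √(1 - k ^ 2) < 1 := by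
    rw [Real.sqrt_lt' one_pos]
    nlinarith
  have hkτ₀ : 0 < k * √(1 - k ^ 2) := mul_pos hk₀ hτ₀
  have hkτ₁ : k * √(1 - k ^ 2) < 1 := mul_lt_one_of_nonneg_of_lt_one_left hk₀.le hk₁ hτ₁.le
  have hσ₀ : 0 < √(1 - (k * √(1 - k ^ 2)) ^ 2) := Real.sqrt_pos.mpr (by nlinarith)
  have hσ₁ : √(1 - (k * √(1 - k ^ 2)) ^ 2) < 1 := by
    rw [Real.sqrt_lt' one_pos]
    nlinarith
  obtain ⟨M, hM, hMF⟩ :=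
    exists_mem_latitudeCircle_forall_overlap_eq_mem h hk₀ hk₁ hσ₀ hσ₁ k hF
  obtain ⟨p, hp, q, hq, hpq, hpM, hqM⟩ :=
    exists_two_mem_latitudeCircle_overlap_eq_self h hk₀ hk₁ hM
  refine ⟨M, hM.1, hM.2 ▸ hσ₀, ?_, p, ⟨hMF p hp hpM, hp⟩, q, ⟨hMF q hq hqM, hq⟩, hpq, hpM, hqM⟩
  rw [overlap_right_of_mem_latitudeCircle h hM, Real.sq_sqrt (by nlinarith), sub_sub_cancel,
    Real.sqrt_sq hkτ₀.le]

theorem overlap_eq_zero_or_of_finite_diff (h : overlap N N' = 0) (hk₀ : 0 < k) (hk₁ : k < 1)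
    (hF : (latitudeCircle k N N' \ F).Finite) (hx : x ∈ equiangular c F) :
    overlap N x = 0 ∨ overlap N' x = 0 := by
  refine overlap_eq_zero_or_of_mem_equiangular h hk₀ Set.inter_subset_right
    (two_lt_encard_of_infinite fun hinter => infinite_latitudeCircle h hk₀ hk₁ ?_)
    (equiangular_anti (Set.inter_subset_left (s := F)) hx)
  rw [← Set.inter_union_sdiff (latitudeCircle k N N') F, Set.inter_comm]
  exact hinter.union hF

/- Turning the pole `N` of the circle of latitude `r` to a nearby point `M` of the line `NN'` leaves
a point of overlap `c` with two points of the circle of latitude `k` and with `x`, hence with all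
of `F`, although it is orthogonal to neither `N` nor `N'`. -/
theorem CircleLike.false_of_latitudeCircle (hF : CircleLike c F) (h : overlap N N' = 0)
    (hk₀ : 0 < k) (hk₁ : k < 1) (hr₀ : 0 < r) (hr₁ : r < 1) (hkr : k * r = c)
    (hfin : (latitudeCircle k N N' \ F).Finite) (hNY : overlap N Y = 0) (hN'Y : overlap N' Y = 0)
    (hx : x ∈ F) (hline : ¬OnLine N N' x) (hNx : overlap N x = 0)
    (hYx : √(1 - r ^ 2) * overlap Y x = c) : False := by
  obtain ⟨M, hM, hNM, hN'M, p, hp, q, hq, hpq, hpM, hqM⟩ :=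
    exists_onLine_two_mem_overlap_eq h hk₀ hk₁ hfin
  have hτ₀ : 0 < √(1 - k ^ 2) := Real.sqrt_pos.mpr (by nlinarith)
  have hτ₁ : √(1 - k ^ 2) ≤ 1 := Real.sqrt_le_one.mpr (by nlinarith)
  have hMY : overlap M Y = 0 := hM.overlap_eq_zero hNY hN'Y
  have hMx : r * overlap M x < 2 * c := by
    have hle : overlap N' M * overlap N' x ≤ k := by
      rw [hN'M, mul_assoc]
      exact mul_le_of_le_one_right hk₀.le
        (mul_le_one₀ hτ₁ (overlap_nonneg _ _) (overlap_le_one _ _))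
    rw [hM.symm.overlap_eq_mul ((overlap_comm _ _).trans h) hNx, ← hkr]
    nlinarith
  obtain ⟨w, hw, hwx⟩ := exists_mem_latitudeCircle_overlap_eq hMY hr₀ hr₁ hYx hMx
  have hmul {s : ℙ ℂ H} (hs : OnLine N N' s) : overlap s w = r * overlap s M := by
    rw [overlap_comm, overlap_comm s, overlap_eq_mul_of_mem_latitudeCircle hMY hw
      ((overlap_comm _ _).trans (hs.overlap_eq_zero hNY hN'Y))]
  have hne {s : ℙ ℂ H} (hs : OnLine N N' s) : s ≠ x := by
    rintro rfl
    exact hline hs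
  have hsub : {p, q, x} ⊆ F := by
    rintro _ (rfl | rfl | rfl)
    exacts [hp.1, hq.1, hx]
  have hwF : w ∈ equiangular c F := by
    refine hF.equiangular_subset _ hsub (two_lt_encard_iff.mpr
      ⟨p, q, x, by simp, by simp, by simp, hpq, hne hp.2.1, hne hq.2.1⟩) ?_
    rintro _ (rfl | rfl | rfl)
    · rw [hmul hp.2.1, hpM, mul_comm, hkr]
    · rw [hmul hq.2.1, hqM, mul_comm, hkr]
    · rwa [overlap_comm]
  rcases overlap_eq_zero_or_of_finite_diff h hk₀ hk₁ hfin hwF with h₀ | h₀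
  · exact (mul_pos hr₀ hNM).ne' ((hmul (onLine_left N N')).symm.trans h₀)
  · refine (mul_pos hr₀ (mul_pos hk₀ hτ₀)).ne' ?_
    rw [← hN'M, ← hmul (onLine_right N N'), h₀]

theorem CircleLike.exists_not_onLine (hF : CircleLike c F) (hc : 0 < c) (hSF : S ⊆ F)
    (hS : 2 < S.encard) (hline : ∀ s ∈ S, OnLine p q s) (hpq : p ≠ q) :
    ∃ w ∈ equiangular c F, ¬OnLine p q w := by
  by_contra! hcon
  obtain ⟨w₀, hw₀⟩ := hF.infinite_equiangular.nonempty
  obtain ⟨s, -, -, hs, -⟩ := two_lt_encard_iff.mp hS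
  obtain ⟨N, N', hN, hN', hNN', -, hN₀, hcircle⟩ :=
    exists_poles hpq hline ⟨s, hs⟩ hc (equiangular_anti hSF hw₀)
  refine hF.infinite_equiangular ((Set.toFinite {N, N'}).subset fun w hw => ?_)
  have hw' : OnLine N N' w :=
    hN.exchange hN' (ne_of_overlap_eq_zero hNN') (hcon w hw)
  rcases overlap_eq_zero_or_of_mem_equiangular hNN' (div_pos hc hN₀) hcircle hS
    (equiangular_anti hSF hw) with h | h
  · exact .inr (hw'.symm.eq_of_overlap_eq_zero ((overlap_comm _ _).trans hNN') h).symm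
  · exact .inl (hw'.eq_of_overlap_eq_zero hNN' h).symm

theorem CircleLike.finite_latitudeCircle_diff (hF : CircleLike c F) (hk : 0 < k)
    (h : overlap N N' = 0) (hSF : S ⊆ F) (hS : 2 < S.encard)
    (hcircle : S ⊆ latitudeCircle k N N') : (latitudeCircle k N N' \ F).Finite := by
  obtain ⟨s, -, -, hs, -⟩ := two_lt_encard_iff.mp hS
  refine hF.finite_diff.subset (Set.sdiff_subset_sdiff_left fun v hv w hw => ?_)
  rw [overlap_comm, overlap_eq_of_mem_latitudeCircle h hv (hcircle hs)
    (overlap_eq_zero_or_of_mem_equiangular h hk hcircle hS (equiangular_anti hSF hw))]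
  exact hw s (hSF hs)

theorem CircleLike.onLine_of_subset_latitudeCircle (hF : CircleLike c F) (h : overlap N N' = 0)
    (hk₀ : 0 < k) (hk₁ : k < 1) (hr₀ : 0 < r) (hr₁ : r < 1) (hkr : k * r = c) (hSF : S ⊆ F)
    (hS : 2 < S.encard) (hcircle : S ⊆ latitudeCircle k N N') (hx : x ∈ F) : OnLine N N' x := by
  by_contra hline
  obtain ⟨Y, hNY, hN'Y, hYx⟩ := exists_overlap_eq_zero_of_not_onLine hline
  have hsub : latitudeCircle r N Y ⊆ equiangular c F := fun v hv =>
    hF.equiangular_subset S hSF hS fun s hs => by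
      rw [overlap_comm, overlap_eq_mul_of_mem_latitudeCircle hNY hv
        ((overlap_comm _ _).trans ((hcircle hs).1.overlap_eq_zero hNY hN'Y)), (hcircle hs).2,
        mul_comm, hkr]
  have hxv {v} (hv : v ∈ latitudeCircle r N Y) : overlap v x = c :=
    (overlap_comm _ _).trans (hsub hv x hx)
  have hinf := infinite_latitudeCircle hNY hr₀ hr₁
  have hNx : overlap N x = 0 := (overlap_eq_zero_or_of_mem_equiangular hNY hr₀ subset_rfl
    (two_lt_encard_of_infinite hinf) fun v hv => hxv hv).resolve_right
      (overlap_comm x Y ▸ hYx)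
  obtain ⟨v, hv⟩ := hinf.nonempty
  exact hF.false_of_latitudeCircle h hk₀ hk₁ hr₀ hr₁ hkr
    (hF.finite_latitudeCircle_diff hk₀ h hSF hS hcircle) hNY hN'Y hx hline hNx
    ((overlap_eq_sqrt_mul_of_mem_latitudeCircle hNY hv hNx).symm.trans (hxv hv))

theorem CircleLike.onLine_of_subset (hF : CircleLike c F) (hc : 0 < c) (hSF : S ⊆ F)
    (hS : 2 < S.encard) (hline : ∀ s ∈ S, OnLine p q s) (hpq : p ≠ q) (hx : x ∈ F) :
    OnLine p q x := by
  obtain ⟨w, hw, hpqw⟩ := hF.exists_not_onLine hc hSF hS hline hpq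
  obtain ⟨s, t, -, hs, ht, -, hst, -⟩ := two_lt_encard_iff.mp hS
  obtain ⟨N, N', hN, hN', hNN', -, hN₀, hcircle⟩ :=
    exists_poles hpq hline ⟨s, hs⟩ hc (equiangular_anti hSF hw)
  have hkr : c / overlap N w * overlap N w = c := div_mul_cancel₀ _ hN₀.ne'
  have hNw : N ≠ w := by
    rintro rfl
    exact hpqw hN
  have hk₁ : c / overlap N w ≠ 1 := fun h => hst <| by
    have heq {u} (hu : u ∈ S) : N = u := overlap_eq_one_iff.mp ((hcircle hu).2.trans h)
    exact (heq hs).symm.trans (heq ht)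
  have hk₁' : c / overlap N w ≤ 1 := (hcircle hs).2 ▸ overlap_le_one N s
  have := hF.onLine_of_subset_latitudeCircle hNN' (div_pos hc hN₀) (hk₁'.lt_of_ne hk₁) hN₀
    ((overlap_le_one _ _).lt_of_ne fun h => hNw (overlap_eq_one_iff.mp h)) hkr hSF hS hcircle hx
  exact this.trans (sup_le hN hN')

theorem CircleLike.onLine (hF : CircleLike c F) (hc : 0 < c) (hp : p ∈ F) (hq : q ∈ F)
    (hx : x ∈ F) (hpq : p ≠ q) : OnLine p q x := by
  have hcap := hF.not_isCap hc
  simp only [IsCap, not_forall, not_not] at hcap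
  obtain ⟨a, ha, b, hb, d, hd, hab, had, hbd, hline⟩ := hcap
  have hall {y} (hy : y ∈ F) : OnLine a b y := by
    refine hF.onLine_of_subset hc (S := {a, b, d}) ?_ (two_lt_encard_iff.mpr
      ⟨a, b, d, by simp, by simp, by simp, hab, had, hbd⟩) ?_ hab hy
    · rintro _ (rfl | rfl | rfl) <;> assumption
    · rintro _ (rfl | rfl | rfl)
      exacts [onLine_left _ _, onLine_right _ _, hline]
  exact (hall hp).exchange (hall hq) hpq (hall hx)

end CollinearityOfCircleLikeSets

section GreatCircles

variable {H : Type*} [NormedAddCommGroup H] [InnerProductSpace ℂ H] {c : ℝ}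
  {N N' R Y p x : ℙ ℂ H}

/-- The points of the projective line `NN'` which lie, for orthogonal `N` and `N'`, half-way
between `N` and `N'`: the equator of the Bloch sphere with poles `N` and `N'`. -/
noncomputable def greatCircle (N N' : ℙ ℂ H) : Set (ℙ ℂ H) := latitudeCircle (√2)⁻¹ N N'

theorem inv_sqrt_two_lt_one : (√2)⁻¹ < 1 :=
  inv_lt_one_of_one_lt₀ (Real.lt_sqrt_of_sq_lt (by norm_num))

theorem sqrt_one_sub_inv_sqrt_two_sq : √(1 - (√2)⁻¹ ^ 2) = (√2)⁻¹ := by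
  rw [inv_pow, Real.sq_sqrt zero_le_two, ← Real.sqrt_inv]
  norm_num

theorem overlap_right_of_mem_greatCircle (h : overlap N N' = 0) (hp : p ∈ greatCircle N N') :
    overlap N' p = (√2)⁻¹ := by
  rw [overlap_right_of_mem_latitudeCircle h hp, sqrt_one_sub_inv_sqrt_two_sq]

theorem greatCircle_comm (h : overlap N N' = 0) : greatCircle N N' = greatCircle N' N :=
  Set.Subset.antisymm (fun _ hp => ⟨hp.1.symm, overlap_right_of_mem_greatCircle h hp⟩)
    fun _ hp => ⟨hp.1.symm, overlap_right_of_mem_greatCircle ((overlap_comm _ _).trans h) hp⟩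

theorem mem_greatCircle_of_overlap_eq (h : overlap N N' = 0) (hN : overlap N p = (√2)⁻¹)
    (hN' : overlap N' p = (√2)⁻¹) : p ∈ greatCircle N N' := by
  refine ⟨(onLine_iff_overlap_sq_add_overlap_sq h).mpr ?_, hN⟩
  rw [hN, hN', inv_pow, Real.sq_sqrt zero_le_two]
  norm_num

theorem latitudeCircle_subset_equiangular_greatCircle (hNY : overlap N Y = 0)
    (hN'Y : overlap N' Y = 0) :
    latitudeCircle (√2 * c) N Y ⊆ equiangular c (greatCircle N N') := fun v hv p hp => by
  have hYp : overlap Y p = 0 := (overlap_comm _ _).trans (hp.1.overlap_eq_zero hNY hN'Y)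
  rw [overlap_comm, overlap_eq_mul_of_mem_latitudeCircle hNY hv hYp, hp.2, mul_right_comm,
    mul_inv_cancel₀ (by positivity), one_mul]

theorem infinite_latitudeCircle_sqrt_two_mul (hc : 0 < c) (hc2 : 2 * c ^ 2 < 1)
    (h : overlap N Y = 0) : (latitudeCircle (√2 * c) N Y).Infinite := by
  refine infinite_latitudeCircle h (by positivity) ?_
  rw [← Real.sqrt_one, ← Real.sqrt_sq hc.le, ← Real.sqrt_mul zero_le_two]
  exact Real.sqrt_lt_sqrt (by positivity) hc2

theorem overlap_eq_zero_or_of_mem_equiangular_equiangular (hc : 0 < c) (hc2 : 2 * c ^ 2 < 1)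
    (hNY : overlap N Y = 0) (hN'Y : overlap N' Y = 0)
    (hx : x ∈ equiangular c (equiangular c (greatCircle N N'))) :
    overlap N x = 0 ∨ overlap Y x = 0 :=
  overlap_eq_zero_or_of_mem_equiangular hNY (by positivity) subset_rfl
    (two_lt_encard_of_infinite (infinite_latitudeCircle_sqrt_two_mul hc hc2 hNY))
    (equiangular_anti (latitudeCircle_subset_equiangular_greatCircle hNY hN'Y) hx)

theorem overlap_eq_inv_sqrt_two_of_mem_equiangular_equiangular (hc : 0 < c) (hc2 : 2 * c ^ 2 < 1)
    (hNY : overlap N Y = 0) (hN'Y : overlap N' Y = 0)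
    (hx : x ∈ equiangular c (equiangular c (greatCircle N N'))) (hYx : overlap Y x = 0) :
    overlap N x = (√2)⁻¹ := by
  obtain ⟨v, hv⟩ := (infinite_latitudeCircle_sqrt_two_mul hc hc2 hNY).nonempty
  have hvx := hx v (latitudeCircle_subset_equiangular_greatCircle hNY hN'Y hv)
  rw [overlap_eq_mul_of_mem_latitudeCircle hNY hv hYx, mul_right_comm] at hvx
  exact eq_inv_of_mul_eq_one_right (mul_right_cancel₀ hc.ne' (hvx.trans (one_mul c).symm))

theorem mem_greatCircle_of_mem_equiangular_equiangular (hc : 0 < c) (hc2 : 2 * c ^ 2 < 1)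
    (h : overlap N N' = 0) (hNY : overlap N Y = 0) (hN'Y : overlap N' Y = 0)
    (hx : x ∈ equiangular c (equiangular c (greatCircle N N'))) (hYx : overlap Y x = 0) :
    x ∈ greatCircle N N' :=
  mem_greatCircle_of_overlap_eq h
    (overlap_eq_inv_sqrt_two_of_mem_equiangular_equiangular hc hc2 hNY hN'Y hx hYx)
    (overlap_eq_inv_sqrt_two_of_mem_equiangular_equiangular hc hc2 hN'Y hNY
      (greatCircle_comm h ▸ hx) hYx)

theorem subsingleton_equiangular_equiangular_diff (hc : 0 < c) (hc2 : 2 * c ^ 2 < 1)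
    (h : overlap N N' = 0) (hNR : overlap N R = 0) (hN'R : overlap N' R = 0) :
    (equiangular c (equiangular c (greatCircle N N')) \ greatCircle N N').Subsingleton := by
  have hnot {x Y : ℙ ℂ H} (hx : x ∈ equiangular c (equiangular c (greatCircle N N')) \
      greatCircle N N') (hNY : overlap N Y = 0) (hN'Y : overlap N' Y = 0) : overlap Y x ≠ 0 :=
    fun hYx => hx.2
      (mem_greatCircle_of_mem_equiangular_equiangular hc hc2 h hNY hN'Y hx.1 hYx)
  have hpole {x} (hx : x ∈ equiangular c (equiangular c (greatCircle N N')) \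
      greatCircle N N') : overlap x N = 0 ∧ overlap x N' = 0 := by
    rw [overlap_comm x, overlap_comm x]
    exact ⟨(overlap_eq_zero_or_of_mem_equiangular_equiangular hc hc2 hNR hN'R
      hx.1).resolve_right (hnot hx hNR hN'R),
      (overlap_eq_zero_or_of_mem_equiangular_equiangular hc hc2 hN'R hNR
      (greatCircle_comm h ▸ hx.1)).resolve_right (hnot hx hNR hN'R)⟩
  intro x hx y hy
  by_contra hxy
  obtain ⟨Y, hY, hYx⟩ := exists_onLine_overlap_eq_zero hxy x
  refine hnot hx ?_ ?_ hYx <;> rw [overlap_comm]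
  exacts [hY.overlap_eq_zero (hpole hx).1 (hpole hy).1,
    hY.overlap_eq_zero (hpole hx).2 (hpole hy).2]

theorem circleLike_greatCircle (hc : 0 < c) (hc2 : 2 * c ^ 2 < 1) (h : overlap N N' = 0)
    (hNR : overlap N R = 0) (hN'R : overlap N' R = 0) : CircleLike c (greatCircle N N') where
  infinite := infinite_latitudeCircle h (by positivity) inv_sqrt_two_lt_one
  infinite_equiangular := (infinite_latitudeCircle_sqrt_two_mul hc hc2 hNR).mono
    (latitudeCircle_subset_equiangular_greatCircle hNR hN'R)
  equiangular_subset S hS hcard x hx p hp := by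
    obtain ⟨s, -, -, hs, -⟩ := two_lt_encard_iff.mp hcard
    rw [overlap_eq_of_mem_latitudeCircle h hp (hS hs)
      (overlap_eq_zero_or_of_mem_equiangular h (by positivity) hS hcard hx), hx s hs]
  finite_diff := (subsingleton_equiangular_equiangular_diff hc hc2 h hNR hN'R).finite

end GreatCircles

section LinePreservation

variable {H : Type*} [NormedAddCommGroup H] [InnerProductSpace ℂ H] {c : ℝ} {F : Set (ℙ ℂ H)}
  {e : ℙ ℂ H ≃ ℙ ℂ H} {p q r N N' P : ℙ ℂ H}

theorem inner_latitudeVector_latitudeVector {e₁ e₂ : H} (h₁ : ‖e₁‖ = 1) (h₂ : ‖e₂‖ = 1)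
    (h : inner ℂ e₁ e₂ = 0) (k l : ℝ) (z w : ℂ) :
    inner ℂ (latitudeVector k e₁ e₂ z) (latitudeVector l e₁ e₂ w) =
      k * l + √(1 - k ^ 2) * √(1 - l ^ 2) * (star z * w) := by
  simp only [latitudeVector, inner_add_left, inner_add_right, inner_smul_left, inner_smul_right,
    h, inner_eq_zero_symm.mp h, inner_self_eq_one_of_norm_eq_one h₁,
    inner_self_eq_one_of_norm_eq_one h₂, map_mul, Complex.conj_ofReal, Complex.star_def]
  ring

theorem overlap_ray_latitudeVector_eq_inv_sqrt_two {e₁ e₂ : H} (h₁ : ‖e₁‖ = 1) (h₂ : ‖e₂‖ = 1)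
    (h : inner ℂ e₁ e₂ = 0) {k : ℝ} (hk₀ : 0 ≤ k) (hk₁ : k ≤ 1) {z w : ℂ} (hz : ‖star w * z‖ = 1)
    (hwz : (star w * z).re = 0) (hv : ‖latitudeVector k e₁ e₂ z‖ = 1)
    (hM : ‖latitudeVector (√2)⁻¹ e₁ e₂ w‖ = 1) : overlap (ray _ hM) (ray _ hv) = (√2)⁻¹ := by
  have hfactor : inner ℂ (latitudeVector (√2)⁻¹ e₁ e₂ w) (latitudeVector k e₁ e₂ z) =
      ((√2)⁻¹ : ℝ) * (k + star w * z * √(1 - k ^ 2)) := by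
    rw [inner_latitudeVector_latitudeVector h₁ h₂ h, sqrt_one_sub_inv_sqrt_two_sq]
    ring
  have hnorm : ‖(k + star w * z * √(1 - k ^ 2) : ℂ)‖ = 1 := by
    rw [← sq_eq_sq₀ (norm_nonneg _) zero_le_one, norm_add_mul_sq _ _ _ hz]
    have hre : (star w * z * (√(1 - k ^ 2) * star (k : ℂ))).re = 0 := by
      rw [Complex.star_def, Complex.conj_ofReal, ← Complex.star_def, ← Complex.ofReal_mul,
        Complex.re_mul_ofReal, hwz, zero_mul]
    rw [hre, Complex.norm_real, Complex.norm_real, Real.norm_eq_abs, Real.norm_eq_abs, sq_abs,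
      sq_abs, Real.sq_sqrt (by nlinarith)]
    ring
  rw [overlap_ray, hfactor, norm_mul, hnorm, mul_one, Complex.norm_real,
    Real.norm_of_nonneg (by positivity)]

/- With `N` and `N'` as poles, `M` and `M'` are the points of the equator a quarter turn away from
the longitude of `P`. -/
theorem exists_greatCircle (h : overlap N N' = 0) (hP : OnLine N N' P) :
    ∃ M M', overlap M M' = 0 ∧ N ∈ greatCircle M M' ∧ N' ∈ greatCircle M M' ∧
      P ∈ greatCircle M M' := by
  obtain ⟨e₁, h₁, rfl⟩ := exists_ray N
  obtain ⟨e₂, h₂, rfl⟩ := exists_ray N'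
  have h' := overlap_ray_eq_zero_iff.mp h
  obtain ⟨z, hv, hz, hzP⟩ := exists_ray_latitudeVector_eq h' ⟨hP, rfl⟩
  have hκ : (0 : ℝ) ≤ (√2)⁻¹ := by positivity
  have hIz : ‖Complex.I * z‖ = 1 := by rw [norm_mul, Complex.norm_I, hz, one_mul]
  have hM := norm_latitudeVector h₁ h₂ h' hκ inv_sqrt_two_lt_one.le hIz
  have hM' := norm_latitudeVector h₁ h₂ h' hκ inv_sqrt_two_lt_one.le ((norm_neg _).trans hIz)
  have hzz : star z * z = 1 := by rw [mul_comm, mul_star_self_of_norm_eq_one hz]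
  have hMM' : overlap (ray _ hM) (ray _ hM') = 0 := by
    rw [overlap_ray_eq_zero_iff, inner_latitudeVector_latitudeVector h₁ h₂ h',
      sqrt_one_sub_inv_sqrt_two_sq, star_mul, Complex.star_def, Complex.conj_I, ← Complex.star_def]
    linear_combination (((√2)⁻¹ : ℝ) : ℂ) ^ 2 * (Complex.I ^ 2 * hzz + Complex.I_sq)
  have hIzz : star (Complex.I * z) * z = -Complex.I := by
    rw [star_mul, Complex.star_def, Complex.conj_I, ← Complex.star_def]
    linear_combination -Complex.I * hzz
  have hmem {w : ℂ} (hw : ‖w‖ = 1) (hwz : (star w * z).re = 0)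
      (hv : ‖latitudeVector (√2)⁻¹ e₁ e₂ w‖ = 1) : overlap (ray _ hv) (ray e₁ h₁) = (√2)⁻¹ ∧
      overlap (ray _ hv) (ray e₂ h₂) = (√2)⁻¹ ∧ overlap (ray _ hv) P = (√2)⁻¹ := by
    have hmem := ray_latitudeVector_mem_latitudeCircle (h₁ := h₁) (h₂ := h₂) h' hκ hv
    rw [overlap_comm _ (ray e₁ h₁), overlap_comm _ (ray e₂ h₂), hmem.2,
      overlap_right_of_mem_greatCircle h hmem, ← hzP]
    exact ⟨rfl, rfl, overlap_ray_latitudeVector_eq_inv_sqrt_two h₁ h₂ h' (overlap_nonneg _ _)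
      (overlap_le_one _ _) (by rw [norm_mul, norm_star, hw, hz, one_mul]) hwz _ hv⟩
  obtain ⟨hMN, hMN', hMP⟩ := hmem hIz (by rw [hIzz]; simp) hM
  obtain ⟨hM'N, hM'N', hM'P⟩ := hmem ((norm_neg _).trans hIz)
    (by rw [star_neg, neg_mul, hIzz]; simp) hM'
  exact ⟨_, _, hMM', mem_greatCircle_of_overlap_eq hMM' hMN hM'N,
    mem_greatCircle_of_overlap_eq hMM' hMN' hM'N', mem_greatCircle_of_overlap_eq hMM' hMP hM'P⟩

/-- The bijection `e` preserves the relation of having overlap `c` in both directions. -/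
def PreservesOverlap (c : ℝ) (e : ℙ ℂ H ≃ ℙ ℂ H) : Prop :=
  ∀ p q, overlap p q = c ↔ overlap (e p) (e q) = c

theorem PreservesOverlap.image_equiangular (he : PreservesOverlap c e) (F : Set (ℙ ℂ H)) :
    e '' equiangular c F = equiangular c (e '' F) := by
  ext w
  obtain ⟨w, rfl⟩ := e.surjective w
  rw [e.injective.mem_set_image]
  exact (forall₂_congr fun p _ => he p w).trans
    (Set.forall_mem_image (p := fun p => overlap p (e w) = c)).symm

theorem CircleLike.image (hF : CircleLike c F) (he : PreservesOverlap c e) :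
    CircleLike c (e '' F) where
  infinite := hF.infinite.image e.injective.injOn
  infinite_equiangular := by
    rw [← he.image_equiangular]
    exact hF.infinite_equiangular.image e.injective.injOn
  equiangular_subset S hS hcard := by
    obtain ⟨T, hTF, rfl⟩ := Set.subset_image_iff.mp hS
    rw [e.injective.encard_image] at hcard
    rw [← he.image_equiangular, ← he.image_equiangular]
    exact Set.image_mono (hF.equiangular_subset T hTF hcard)
  finite_diff := by
    rw [← he.image_equiangular, ← he.image_equiangular, ← Set.image_sdiff e.injective]
    exact hF.finite_diff.image e

theorem PreservesOverlap.onLine_of_overlap_eq_zero (he : PreservesOverlap c e) (hc : 0 < c)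
    (hc2 : 2 * c ^ 2 < 1) (hdim : 3 ≤ Module.rank ℂ H) (h : overlap N N' = 0)
    (hP : OnLine N N' P) : OnLine (e N) (e N') (e P) := by
  obtain ⟨M, M', hMM', hN, hN', hP⟩ := exists_greatCircle h hP
  obtain ⟨R, hMR, hM'R⟩ := exists_overlap_eq_zero hdim M M'
  exact ((circleLike_greatCircle hc hc2 hMM' hMR hM'R).image he).onLine hc
    (Set.mem_image_of_mem e hN) (Set.mem_image_of_mem e hN') (Set.mem_image_of_mem e hP)
    (e.injective.ne (ne_of_overlap_eq_zero h))

theorem PreservesOverlap.onLine (he : PreservesOverlap c e) (hc : 0 < c) (hc2 : 2 * c ^ 2 < 1)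
    (hdim : 3 ≤ Module.rank ℂ H) (hpq : p ≠ q) (hr : OnLine p q r) :
    OnLine (e p) (e q) (e r) := by
  obtain ⟨N, N', hN, hN', h, -⟩ := exists_adapted_pair hpq p
  have hmap {s} (hs : OnLine p q s) : OnLine (e N) (e N') (e s) :=
    he.onLine_of_overlap_eq_zero hc hc2 hdim h
      (hN.exchange hN' (ne_of_overlap_eq_zero h) hs)
  exact (hmap (onLine_left p q)).exchange (hmap (onLine_right p q)) (e.injective.ne hpq) (hmap hr)

end LinePreservation

section OrthogonalityPreservation

variable {H : Type*} [NormedAddCommGroup H] [InnerProductSpace ℂ H] {c : ℝ}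
  {e : ℙ ℂ H ≃ ℙ ℂ H} {p q N R M M' : ℙ ℂ H}

theorem PreservesOverlap.overlap_eq_zero_or (he : PreservesOverlap c e) (hc : 0 < c)
    (hc2 : 2 * c ^ 2 < 1) (hdim : 3 ≤ Module.rank ℂ H) {W : Set (ℙ ℂ H)} (hW : W.Infinite)
    (hline : ∀ w ∈ W, OnLine N R w)
    (hpole : ∀ w ∈ W, overlap M (e w) = 0 ∨ overlap M' (e w) = 0) :
    overlap M (e N) = 0 ∨ overlap M' (e N) = 0 := by
  have hN {L : ℙ ℂ H} (hinf : {w ∈ W | overlap L (e w) = 0}.Infinite) : overlap L (e N) = 0 := by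
    obtain ⟨u, v, -, hu, hv, -, huv, -⟩ := two_lt_encard_iff.mp (two_lt_encard_of_infinite hinf)
    have hNuv := (hline u hu.1).exchange (hline v hv.1) huv (onLine_left N R)
    rw [overlap_comm]
    refine (he.onLine hc hc2 hdim huv hNuv).overlap_eq_zero ?_ ?_ <;> rw [overlap_comm]
    exacts [hu.2, hv.2]
  by_contra! hcon
  refine hW (((Set.not_infinite.mp (mt hN hcon.1)).union
    (Set.not_infinite.mp (mt hN hcon.2))).subset fun w hw => ?_)
  exact (hpole w hw).imp (⟨hw, ·⟩) (⟨hw, ·⟩)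

theorem overlap_eq_zero_of_overlap_eq_zero_or (hp : OnLine M M' p) (hq : OnLine M M' q)
    (h : overlap M M' = 0) (hpq : p ≠ q) (hpM : overlap M p = 0 ∨ overlap M' p = 0)
    (hqM : overlap M q = 0 ∨ overlap M' q = 0) : overlap p q = 0 := by
  have h' : overlap M' M = 0 := (overlap_comm _ _).trans h
  rcases hpM with hpM | hpM
  · obtain rfl := hp.symm.eq_of_overlap_eq_zero h' hpM
    refine hqM.elim (fun hqM => absurd (hq.symm.eq_of_overlap_eq_zero h' hqM) hpq) id
  · obtain rfl := hp.eq_of_overlap_eq_zero h hpM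
    refine hqM.elim id (fun hqM => absurd (hq.eq_of_overlap_eq_zero h hqM) hpq)

/- The points of `equiangular c (greatCircle p q)` on the lines `pR` and `qR` are mapped into
the polar lines of the poles `M` and `M'` of the image of the great circle. Hence `e p` and `e q`
are orthogonal to a pole, that is, they are the poles. -/
theorem PreservesOverlap.overlap_eq_zero (he : PreservesOverlap c e) (hc : 0 < c)
    (hc2 : 2 * c ^ 2 < 1) (hdim : 3 ≤ Module.rank ℂ H) (hpq : overlap p q = 0) :
    overlap (e p) (e q) = 0 := by
  obtain ⟨R, hpR, hqR⟩ := exists_overlap_eq_zero hdim p q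
  have hne := ne_of_overlap_eq_zero hpq
  set F := e '' greatCircle p q with hF
  have hFline : ∀ s ∈ F, OnLine (e p) (e q) s := by
    rintro _ ⟨s, hs, rfl⟩
    exact he.onLine hc hc2 hdim hne hs.1
  have hW₁ := latitudeCircle_subset_equiangular_greatCircle (c := c) hpR hqR
  have hW₂ := latitudeCircle_subset_equiangular_greatCircle (c := c) hqR hpR
  rw [greatCircle_comm ((overlap_comm _ _).trans hpq)] at hW₂
  have hinf₁ := infinite_latitudeCircle_sqrt_two_mul hc hc2 hpR
  have hinf₂ := infinite_latitudeCircle_sqrt_two_mul hc hc2 hqR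
  have hFinf : F.Infinite := (infinite_latitudeCircle hpq (by positivity)
    inv_sqrt_two_lt_one).image e.injective.injOn
  have hmap {w} (hw : w ∈ equiangular c (greatCircle p q)) : e w ∈ equiangular c F := by
    rw [hF, ← he.image_equiangular]
    exact Set.mem_image_of_mem e hw
  obtain ⟨w, hw⟩ := hinf₁.nonempty
  obtain ⟨M, M', hM, hM', h, -, hMw, hcircle⟩ := exists_poles (e.injective.ne hne) hFline
    hFinf.nonempty hc (hmap (hW₁ hw))
  have hpole {w} (hw : w ∈ equiangular c (greatCircle p q)) :
      overlap M (e w) = 0 ∨ overlap M' (e w) = 0 :=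
    overlap_eq_zero_or_of_mem_equiangular h (div_pos hc hMw) hcircle
      (two_lt_encard_of_infinite hFinf) (hmap hw)
  have hMM' := ne_of_overlap_eq_zero h
  exact overlap_eq_zero_of_overlap_eq_zero_or (hM.exchange hM' hMM' (onLine_left _ _))
    (hM.exchange hM' hMM' (onLine_right _ _)) h (e.injective.ne hne)
    (he.overlap_eq_zero_or hc hc2 hdim hinf₁ (fun w hw => hw.1)
      fun w hw => hpole (hW₁ hw))
    (he.overlap_eq_zero_or hc hc2 hdim hinf₂ (fun w hw => hw.1)
      fun w hw => hpole (hW₂ hw))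

end OrthogonalityPreservation

theorem eq_self_of_additive_of_bounded {g : ℝ → ℝ} (h1 : g 1 = 1)
    (hb : ∀ x, 0 ≤ x → x ≤ 1 → |g x - x| ≤ 1)
    (hadd : ∀ x y, 0 ≤ x → 0 ≤ y → x + y ≤ 1 → g (x + y) = g x + g y) {x : ℝ} (hx₀ : 0 ≤ x)
    (hx₁ : x ≤ 1) : g x = x := by
  have half : g (1 / 2) = 1 / 2 := by
    have h := hadd (1 / 2) (1 / 2) (by norm_num) (by norm_num) (by norm_num)
    rw [add_halves, h1] at h
    linarith
  have error_le (n : ℕ) : ∀ x, 0 ≤ x → x ≤ 1 → |g x - x| ≤ (1 / 2) ^ n := by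
    induction n with
    | zero => simpa using hb
    | succ n ih =>
      have error_le_of_le_half : ∀ x, 0 ≤ x → x ≤ 1 / 2 → |g x - x| ≤ (1 / 2) ^ (n + 1) := by
        intro x h₀ h₁
        have h := ih (x + x) (by linarith) (by linarith)
        rw [hadd x x h₀ h₀ (by linarith), show g x + g x - (x + x) = 2 * (g x - x) by ring,
          abs_mul, abs_two] at h
        rw [pow_succ]
        linarith
      intro x h₀ h₁
      rcases le_total x (1 / 2) with h₂ | h₂
      · exact error_le_of_le_half x h₀ h₂
      · have h := hadd (x - 1 / 2) (1 / 2) (by linarith) (by norm_num) (by linarith)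
        rw [sub_add_cancel, half] at h
        rw [h, show g (x - 1 / 2) + 1 / 2 - x = g (x - 1 / 2) - (x - 1 / 2) by ring]
        exact error_le_of_le_half _ (by linarith) (by linarith)
  have hlim := tendsto_pow_atTop_nhds_zero_of_lt_one (r := (1 / 2 : ℝ)) (by norm_num) (by norm_num)
  exact sub_eq_zero.mp (abs_nonpos_iff.mp (ge_of_tendsto' hlim fun n => error_le n x hx₀ hx₁))

section OverlapPreservation

variable {H : Type*} [NormedAddCommGroup H] [InnerProductSpace ℂ H] {c k : ℝ}
  {e : ℙ ℂ H ≃ ℙ ℂ H} {p q x y w N N' : ℙ ℂ H}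

theorem latitudeCircle_nonempty (h : overlap N N' = 0) (hk₀ : 0 ≤ k) (hk₁ : k ≤ 1) :
    (latitudeCircle k N N').Nonempty := by
  obtain ⟨e₁, h₁, rfl⟩ := exists_ray N
  obtain ⟨e₂, h₂, rfl⟩ := exists_ray N'
  rw [overlap_ray_eq_zero_iff] at h
  exact ⟨_, ray_latitudeVector_mem_latitudeCircle h hk₀
    (norm_latitudeVector h₁ h₂ h hk₀ hk₁ norm_one)⟩

theorem OnLine.overlap_sq_add_overlap_sq (hN : OnLine x y N) (hN' : OnLine x y N')
    (hNN' : overlap N N' = 0) (hxy : overlap x y = 0) (hyp : overlap y p = 0) :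
    overlap p N ^ 2 + overlap p N' ^ 2 = overlap p x ^ 2 := by
  have hx := hN.exchange hN' (ne_of_overlap_eq_zero hNN') (onLine_left x y)
  rw [overlap_comm p N, overlap_comm p N', hN.overlap_eq_mul hxy hyp, hN'.overlap_eq_mul hxy hyp,
    overlap_comm x N, overlap_comm x N', overlap_comm p x]
  linear_combination overlap x p ^ 2 * (onLine_iff_overlap_sq_add_overlap_sq hNN').mp hx

/- A point `w` of the line joining `N` to the common polar of `N` and `N'` is related to both `p`
and `q` by the overlap `c`, which factors through `N` before and after applying `e`. -/
theorem PreservesOverlap.overlap_eq_of_onLine_of_le (he : PreservesOverlap c e) (hc : 0 < c)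
    (hc2 : 2 * c ^ 2 < 1) (hdim : 3 ≤ Module.rank ℂ H) (hNN' : overlap N N' = 0)
    (hp : OnLine N N' p) (hq : OnLine N N' q) (hpq : overlap N p = overlap N q)
    (hle : c ≤ overlap N p) : overlap (e N) (e p) = overlap (e N) (e q) := by
  obtain ⟨r, hNr, hN'r⟩ := exists_overlap_eq_zero hdim N N'
  obtain ⟨w, hw, hNw⟩ := latitudeCircle_nonempty hNr (div_nonneg hc.le (overlap_nonneg N p))
    (div_le_one_of_le₀ hle (overlap_nonneg N p))
  have hN'w : overlap N' w = 0 := by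
    rw [overlap_comm]
    exact hw.overlap_eq_zero hNN' ((overlap_comm _ _).trans hN'r)
  have factor {x} (hx : OnLine N N' x) (hxp : overlap N x = overlap N p) :
      overlap (e N) (e x) * overlap (e N) (e w) = c := by
    rw [← (he.onLine hc hc2 hdim (ne_of_overlap_eq_zero hNN') hx).overlap_eq_mul
      (he.overlap_eq_zero hc hc2 hdim hNN') (he.overlap_eq_zero hc hc2 hdim hN'w), ← he,
      hx.overlap_eq_mul hNN' hN'w, hxp, hNw, mul_div_cancel₀ _ (hc.trans_le hle).ne']
  exact mul_right_cancel₀ (right_ne_zero_of_mul ((factor hp rfl).trans_ne hc.ne'))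
    ((factor hp rfl).trans (factor hq hpq.symm).symm)

theorem overlap_eq_iff_of_onLine (hNN' : overlap N N' = 0) (hp : OnLine N N' p)
    (hq : OnLine N N' q) : overlap N p = overlap N q ↔ overlap N' p = overlap N' q := by
  rw [onLine_iff_overlap_sq_add_overlap_sq hNN'] at hp hq
  rw [← sq_eq_sq₀ (overlap_nonneg N p) (overlap_nonneg N q),
    ← sq_eq_sq₀ (overlap_nonneg N' p) (overlap_nonneg N' q)]
  constructor <;> intro h <;> linarith

theorem PreservesOverlap.overlap_eq_of_onLine (he : PreservesOverlap c e) (hc : 0 < c)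
    (hc2 : 2 * c ^ 2 < 1) (hdim : 3 ≤ Module.rank ℂ H) (hNN' : overlap N N' = 0)
    (hp : OnLine N N' p) (hq : OnLine N N' q) (hpq : overlap N p = overlap N q) :
    overlap (e N) (e p) = overlap (e N) (e q) := by
  rcases le_total c (overlap N p) with hle | hle
  · exact he.overlap_eq_of_onLine_of_le hc hc2 hdim hNN' hp hq hpq hle
  have hne := ne_of_overlap_eq_zero hNN'
  have hle' : c ≤ overlap N' p := by
    have hsum := (onLine_iff_overlap_sq_add_overlap_sq hNN').mp hp
    have hsq := pow_le_pow_left₀ (overlap_nonneg N p) hle 2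
    exact (pow_le_pow_iff_left₀ hc.le (overlap_nonneg _ _) two_ne_zero).mp (by linarith)
  rw [overlap_eq_iff_of_onLine (he.overlap_eq_zero hc hc2 hdim hNN')
    (he.onLine hc hc2 hdim hne hp) (he.onLine hc hc2 hdim hne hq)]
  exact he.overlap_eq_of_onLine_of_le hc hc2 hdim ((overlap_comm _ _).trans hNN') hp.symm hq.symm
    ((overlap_eq_iff_of_onLine hNN' hp hq).mp hpq) hle'

theorem PreservesOverlap.overlap_eq_of_overlap_eq (he : PreservesOverlap c e) (hc : 0 < c)
    (hc2 : 2 * c ^ 2 < 1) (hdim : 3 ≤ Module.rank ℂ H) (h : overlap x p = overlap x q) :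
    overlap (e x) (e p) = overlap (e x) (e q) := by
  rcases eq_or_ne p q with rfl | hpq
  · rfl
  rcases eq_or_ne (overlap x p) 0 with h₀ | h₀
  · rw [he.overlap_eq_zero hc hc2 hdim h₀, he.overlap_eq_zero hc hc2 hdim (h ▸ h₀)]
  obtain ⟨N, N', hN, hN', hNN', hN'x⟩ := exists_adapted_pair hpq x
  have hne := ne_of_overlap_eq_zero hNN'
  have hp := hN.exchange hN' hne (onLine_left p q)
  have hq := hN.exchange hN' hne (onLine_right p q)
  have hNpq : overlap N p = overlap N q := by
    rw [overlap_comm x p, hp.overlap_eq_mul hNN' hN'x] at h h₀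
    rw [overlap_comm x q, hq.overlap_eq_mul hNN' hN'x] at h
    exact mul_right_cancel₀ (right_ne_zero_of_mul h₀) h
  have hNN'e := he.overlap_eq_zero hc hc2 hdim hNN'
  have hN'xe := he.overlap_eq_zero hc hc2 hdim hN'x
  rw [overlap_comm (e x), overlap_comm (e x),
    (he.onLine hc hc2 hdim hne hp).overlap_eq_mul hNN'e hN'xe,
    (he.onLine hc hc2 hdim hne hq).overlap_eq_mul hNN'e hN'xe,
    he.overlap_eq_of_onLine hc hc2 hdim hNN' hp hq hNpq]

theorem exists_overlap_sq_eq (hdim : 3 ≤ Module.rank ℂ H) (p : ℙ ℂ H) {s : ℝ} (hs₀ : 0 ≤ s)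
    (hs₁ : s ≤ 1) : ∃ x, overlap p x ^ 2 = s := by
  obtain ⟨q, hpq, -⟩ := exists_overlap_eq_zero hdim p p
  obtain ⟨x, -, hx⟩ := latitudeCircle_nonempty hpq (Real.sqrt_nonneg s) (Real.sqrt_le_one.mpr hs₁)
  exact ⟨x, by rw [hx, Real.sq_sqrt hs₀]⟩

theorem exists_orthogonal_decomposition (hdim : 3 ≤ Module.rank ℂ H) (p x : ℙ ℂ H) {t : ℝ}
    (ht₀ : 0 ≤ t) (ht₁ : t ≤ 1) :
    ∃ y N N', overlap x y = 0 ∧ overlap y p = 0 ∧ OnLine x y N ∧ OnLine x y N' ∧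
      overlap N N' = 0 ∧ overlap p N ^ 2 = t * overlap p x ^ 2 := by
  obtain ⟨y, hxy, hpy⟩ := exists_overlap_eq_zero hdim x p
  obtain ⟨N, hN, hxN⟩ := latitudeCircle_nonempty hxy (Real.sqrt_nonneg t)
    (Real.sqrt_le_one.mpr ht₁)
  obtain ⟨N', hN', hNN'⟩ := exists_onLine_overlap_eq_zero (ne_of_overlap_eq_zero hxy) N
  have hyp := (overlap_comm y p).trans hpy
  refine ⟨y, N, N', hxy, hyp, hN, hN', (overlap_comm _ _).trans hNN', ?_⟩
  rw [overlap_comm, hN.overlap_eq_mul hxy hyp, mul_pow, hxN, Real.sq_sqrt ht₀, overlap_comm]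

/- The squared overlap of the images is a function `g` of the squared overlap, and `g` is additive
because squared overlaps with an orthogonal pair of points on a line add up, by Pythagoras. -/
theorem PreservesOverlap.overlap_map (he : PreservesOverlap c e) (hc : 0 < c)
    (hc2 : 2 * c ^ 2 < 1) (hdim : 3 ≤ Module.rank ℂ H) (p q : ℙ ℂ H) :
    overlap (e p) (e q) = overlap p q := by
  have hfactors : Function.FactorsThrough (fun r => overlap (e p) (e r) ^ 2)
      (fun r => overlap p r ^ 2) := fun r s hrs => congrArg (· ^ 2) <|
    he.overlap_eq_of_overlap_eq hc hc2 hdim <|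
      (sq_eq_sq₀ (overlap_nonneg _ _) (overlap_nonneg _ _)).mp hrs
  obtain ⟨g, hg⟩ := (Function.factorsThrough_iff _).mp hfactors
  replace hg (r) : overlap (e p) (e r) ^ 2 = g (overlap p r ^ 2) := congrFun hg r
  have hsq_le (r s : ℙ ℂ H) : overlap r s ^ 2 ≤ 1 :=
    pow_le_one₀ (overlap_nonneg _ _) (overlap_le_one _ _)
  rw [← sq_eq_sq₀ (overlap_nonneg _ _) (overlap_nonneg _ _), hg]
  refine eq_self_of_additive_of_bounded ?_ (fun s hs₀ hs₁ => ?_) (fun s t hs ht hst => ?_)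
    (sq_nonneg _) (hsq_le p q)
  · simpa only [overlap_self, one_pow] using (hg p).symm
  · obtain ⟨x, rfl⟩ := exists_overlap_sq_eq hdim p hs₀ hs₁
    rw [← hg, abs_le]
    constructor <;> linarith [sq_nonneg (overlap (e p) (e x)), hsq_le (e p) (e x)]
  · obtain ⟨x, hx⟩ := exists_overlap_sq_eq hdim p (add_nonneg hs ht) hst
    obtain ⟨y, N, N', hxy, hyp, hN, hN', hNN', hpN⟩ := exists_orthogonal_decomposition hdim p x
      (div_nonneg hs (add_nonneg hs ht))
      (div_le_one_of_le₀ (le_add_of_nonneg_right ht) (add_nonneg hs ht))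
    have hs' : overlap p N ^ 2 = s := by
      rw [hpN, hx]
      exact div_mul_cancel_of_imp fun h => by linarith
    have ht' : overlap p N' ^ 2 = t := by
      linarith [hN.overlap_sq_add_overlap_sq hN' hNN' hxy hyp]
    have hne := ne_of_overlap_eq_zero hxy
    rw [← hx, ← hs', ← ht', ← hg, ← hg, ← hg]
    exact ((he.onLine hc hc2 hdim hne hN).overlap_sq_add_overlap_sq
      (he.onLine hc hc2 hdim hne hN') (he.overlap_eq_zero hc hc2 hdim hNN')
      (he.overlap_eq_zero hc hc2 hdim hxy) (he.overlap_eq_zero hc hc2 hdim hyp)).symm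

end OverlapPreservation

theorem exists_linearMap_eq_of_inner_eq {E F : Type*} [NormedAddCommGroup E]
    [InnerProductSpace ℝ E] [NormedAddCommGroup F] [InnerProductSpace ℝ F] {V : E → F}
    (hV : ∀ x y, inner ℝ (V x) (V y) = inner ℝ x y) : ∃ L : E →ₗ[ℝ] F, ⇑L = V := by
  have hnorm (x : E) : ‖V x‖ ^ 2 = ‖x‖ ^ 2 := by
    rw [← real_inner_self_eq_norm_sq, ← real_inner_self_eq_norm_sq, hV]
  have hisometry : Isometry V := Isometry.of_dist_eq fun x y => by
    rw [dist_eq_norm, dist_eq_norm, ← sq_eq_sq₀ (norm_nonneg _) (norm_nonneg _),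
      norm_sub_sq_real, norm_sub_sq_real, hnorm, hnorm, hV]
  have hzero : V 0 = 0 := by
    simpa using hnorm 0
  refine ⟨hisometry.affineIsometryOfStrictConvexSpace.linear, funext fun x => ?_⟩
  simpa [hzero] using (hisometry.affineIsometryOfStrictConvexSpace.map_vadd 0 x).symm

section ComplexModules

variable {E F : Type*} [AddCommGroup E] [Module ℂ E] [AddCommGroup F] [Module ℂ F]

theorem map_I_smul_eq_or_forall (L : E →ₗ[ℝ] F)
    (h : ∀ x, L (Complex.I • x) = Complex.I • L x ∨ L (Complex.I • x) = -(Complex.I • L x)) :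
    (∀ x, L (Complex.I • x) = Complex.I • L x) ∨
      ∀ x, L (Complex.I • x) = -(Complex.I • L x) := by
  by_contra! hcon
  obtain ⟨⟨x, hx⟩, y, hy⟩ := hcon
  have hx' := (h x).resolve_left hx
  have hy' := (h y).resolve_right hy
  have hxy := h (x + y)
  rw [smul_add, map_add, map_add, smul_add, hx', hy', neg_add, add_left_inj, add_right_inj] at hxy
  exact hxy.elim (fun hxy => hx (hx'.trans hxy)) fun hxy => hy (hy'.trans hxy)

theorem map_smul_of_map_I_smul {σ : ℂ →+* ℂ} (hσ : ∀ r : ℝ, σ r = r) (L : E →ₗ[ℝ] F)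
    (hI : ∀ x, L (Complex.I • x) = σ Complex.I • L x) (t : ℂ) (x : E) : L (t • x) = σ t • L x := by
  conv_lhs => rw [← Complex.re_add_im t]
  conv_rhs => rw [← Complex.re_add_im t]
  rw [add_smul, mul_smul, map_add, Complex.coe_smul, Complex.coe_smul, map_smul, map_smul, hI,
    map_add, map_mul, hσ, hσ, add_smul, mul_smul, Complex.coe_smul, Complex.coe_smul]

end ComplexModules

section InnerProductPreservation

variable {E F : Type*} [NormedAddCommGroup E] [InnerProductSpace ℂ E] [NormedAddCommGroup F]
  [InnerProductSpace ℂ F]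

theorem exists_linearMap_eq_of_re_inner_eq {V : E → F}
    (hV : ∀ x y, (inner ℂ (V x) (V y)).re = (inner ℂ x y).re) : ∃ L : E →ₗ[ℝ] F, ⇑L = V :=
  letI := InnerProductSpace.complexToReal (G := E)
  letI := InnerProductSpace.complexToReal (G := F)
  exists_linearMap_eq_of_inner_eq hV

theorem norm_eq_of_norm_inner_eq {V : E → F}
    (hV : ∀ x y, ‖inner ℂ (V x) (V y)‖ = ‖inner ℂ x y‖) (x : E) : ‖V x‖ = ‖x‖ := by
  rw [← sq_eq_sq₀ (norm_nonneg _) (norm_nonneg _)]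
  simpa [inner_self_eq_norm_sq_to_K] using hV x x

theorem eq_I_smul_of_inner_eq {v w : E} (h : inner ℂ v w = Complex.I * ‖v‖ ^ 2)
    (hvw : ‖w‖ = ‖v‖) : w = Complex.I • v := by
  have hinner : inner ℂ w (Complex.I • v) = (‖v‖ : ℂ) ^ 2 := by
    rw [inner_smul_right, ← inner_conj_symm, h, map_mul, Complex.conj_I, map_pow,
      Complex.conj_ofReal, ← mul_assoc, mul_neg, Complex.I_mul_I, neg_neg, one_mul]
  rw [← sub_eq_zero, ← norm_eq_zero, ← sq_eq_zero_iff, @norm_sub_sq ℂ, hinner, norm_smul,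
    Complex.norm_I, one_mul, hvw, ← Complex.ofReal_pow, RCLike.re_eq_complex_re,
    Complex.ofReal_re]
  ring

theorem map_I_smul_eq_or {V : E → F} (hre : ∀ x y, (inner ℂ (V x) (V y)).re = (inner ℂ x y).re)
    (hV : ∀ x y, ‖inner ℂ (V x) (V y)‖ = ‖inner ℂ x y‖) (x : E) :
    V (Complex.I • x) = Complex.I • V x ∨ V (Complex.I • x) = -(Complex.I • V x) := by
  have hnorm := norm_eq_of_norm_inner_eq hV
  have hnormI : ‖V (Complex.I • x)‖ = ‖V x‖ := by
    rw [hnorm, hnorm, norm_smul, Complex.norm_I, one_mul]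
  have hre₀ : (inner ℂ (V x) (V (Complex.I • x))).re = 0 := by
    rw [hre, inner_smul_right, Complex.I_mul_re, neg_eq_zero]
    exact inner_self_im (𝕜 := ℂ) x
  have him : (inner ℂ (V x) (V (Complex.I • x))).im ^ 2 = (‖V x‖ ^ 2) ^ 2 := by
    have h := congrArg (· ^ 2) (hV x (Complex.I • x))
    simpa [← Complex.normSq_eq_norm_sq, Complex.normSq_apply, hre₀, inner_smul_right, ← sq,
      inner_self_eq_norm_sq_to_K, hnorm] using h
  rcases sq_eq_sq_iff_eq_or_eq_neg.mp him with him | him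
  · refine Or.inl (eq_I_smul_of_inner_eq (Complex.ext ?_ ?_) hnormI) <;>
      simp [hre₀, him, ← Complex.ofReal_pow]
  · rw [← neg_eq_iff_eq_neg]
    refine Or.inr (eq_I_smul_of_inner_eq (Complex.ext ?_ ?_) (by rwa [norm_neg])) <;>
      simp [hre₀, him, ← Complex.ofReal_pow, inner_neg_right]

theorem exists_linearIsometry_eq_or_exists_conjLinearIsometry_eq {V : E → F}
    (hre : ∀ x y, (inner ℂ (V x) (V y)).re = (inner ℂ x y).re)
    (hV : ∀ x y, ‖inner ℂ (V x) (V y)‖ = ‖inner ℂ x y‖) :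
    (∃ U : E →ₗᵢ[ℂ] F, ⇑U = V) ∨ ∃ U : E →ₛₗᵢ[starRingEnd ℂ] F, ⇑U = V := by
  obtain ⟨L, rfl⟩ := exists_linearMap_eq_of_re_inner_eq hre
  have semilinear {σ : ℂ →+* ℂ} (hσ : ∀ r : ℝ, σ r = r)
      (hI : ∀ x, L (Complex.I • x) = σ Complex.I • L x) : ∃ U : E →ₛₗᵢ[σ] F, ⇑U = L :=
    ⟨⟨⟨L.toAddHom, map_smul_of_map_I_smul hσ L hI⟩, norm_eq_of_norm_inner_eq hV⟩, rfl⟩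
  refine (map_I_smul_eq_or_forall L (map_I_smul_eq_or hre hV)).imp
    (fun hI => semilinear (fun _ => rfl) hI) fun hI => semilinear Complex.conj_ofReal fun x => ?_
  rw [hI, Complex.conj_I, neg_smul]

end InnerProductPreservation

section AffineCharts

variable {H : Type*} [NormedAddCommGroup H] [InnerProductSpace ℂ H] {e : H}

theorem inner_add_add_of_mem_orthogonal (he : ‖e‖ = 1) (x y : (ℂ ∙ e)ᗮ) :
    inner ℂ (e + x) (e + y) = 1 + inner ℂ x y := by
  have hx := Submodule.mem_orthogonal_singleton_iff_inner_left.mp x.2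
  have hy := Submodule.mem_orthogonal_singleton_iff_inner_right.mp y.2
  rw [inner_add_left, inner_add_right, inner_add_right, inner_self_eq_one_of_norm_eq_one he, hx,
    hy, add_zero, zero_add, Submodule.coe_inner]

theorem norm_smul_add_sq_of_mem_orthogonal (he : ‖e‖ = 1) (a : ℂ) (x : (ℂ ∙ e)ᗮ) :
    ‖a • e + x‖ ^ 2 = ‖a‖ ^ 2 + ‖x‖ ^ 2 := by
  have h : inner ℂ (a • e) (x : H) = 0 := by
    rw [inner_smul_left, Submodule.mem_orthogonal_singleton_iff_inner_right.mp x.2, mul_zero]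
  rw [sq, norm_add_sq_eq_norm_sq_add_norm_sq_of_inner_eq_zero _ _ h, norm_smul, he, mul_one,
    ← sq, ← sq, Submodule.coe_norm]

theorem norm_add_sq_of_mem_orthogonal (he : ‖e‖ = 1) (x : (ℂ ∙ e)ᗮ) :
    ‖e + x‖ ^ 2 = 1 + ‖x‖ ^ 2 := by
  simpa using norm_smul_add_sq_of_mem_orthogonal he 1 x

theorem add_ne_zero_of_mem_orthogonal (he : ‖e‖ = 1) (x : (ℂ ∙ e)ᗮ) : e + x ≠ 0 := by
  rw [← norm_ne_zero_iff, ← sq_pos_iff, norm_add_sq_of_mem_orthogonal he]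
  positivity

/-- The affine chart of the projective space centred at the line spanned by a unit vector `e`. It
covers the lines which are not orthogonal to `e`. -/
noncomputable def affineChart (he : ‖e‖ = 1) (x : (ℂ ∙ e)ᗮ) : ℙ ℂ H :=
  Projectivization.mk ℂ (e + x) (add_ne_zero_of_mem_orthogonal he x)

theorem overlap_affineChart (he : ‖e‖ = 1) (x y : (ℂ ∙ e)ᗮ) :
    overlap (affineChart he x) (affineChart he y) =
      ‖1 + inner ℂ x y‖ / (‖e + x‖ * ‖e + y‖) := by
  rw [affineChart, affineChart, overlap_mk, inner_add_add_of_mem_orthogonal he]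

theorem affineChart_zero (he : ‖e‖ = 1) : affineChart he 0 = ray e he := by
  simp only [affineChart, ray, Submodule.coe_zero, add_zero]

theorem overlap_ray_affineChart (he : ‖e‖ = 1) (x : (ℂ ∙ e)ᗮ) :
    overlap (ray e he) (affineChart he x) = ‖e + x‖⁻¹ := by
  rw [← affineChart_zero, overlap_affineChart, inner_zero_left, add_zero, Submodule.coe_zero,
    add_zero, he, one_mul, norm_one, one_div]

theorem exists_affineChart_eq (he : ‖e‖ = 1) {p : ℙ ℂ H} (hp : overlap (ray e he) p ≠ 0) :
    ∃ x, affineChart he x = p := by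
  obtain ⟨u, hu, rfl⟩ := exists_ray p
  rw [overlap_ray, norm_ne_zero_iff] at hp
  refine ⟨⟨(inner ℂ e u)⁻¹ • u - e, ?_⟩, ?_⟩
  · rw [Submodule.mem_orthogonal_singleton_iff_inner_right, inner_sub_right, inner_smul_right,
      inv_mul_cancel₀ hp, inner_self_eq_one_of_norm_eq_one he, sub_self]
  · exact (Projectivization.mk_eq_mk_iff' ℂ _ _ _ _).mpr ⟨_, (add_sub_cancel _ _).symm⟩

theorem mk_eq_of_onLine_affineChart (he : ‖e‖ = 1) {p : ℙ ℂ H} {x : (ℂ ∙ e)ᗮ}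
    (hx : (x : H) ≠ 0) (hp : overlap (ray e he) p = 0)
    (hline : OnLine (ray e he) p (affineChart he x)) : Projectivization.mk ℂ (x : H) hx = p := by
  obtain ⟨u, hu, rfl⟩ := exists_ray p
  rw [overlap_ray_eq_zero_iff] at hp
  obtain ⟨a, b, hab⟩ := onLine_mk_iff.mp hline
  have ha : a = 1 := by
    simpa [inner_add_right, inner_smul_right, hp, he,
      Submodule.mem_orthogonal_singleton_iff_inner_right.mp x.2] using congrArg (inner ℂ e) hab
  rw [ha, one_smul, add_right_inj] at hab
  exact (Projectivization.mk_eq_mk_iff' ℂ _ _ _ _).mpr ⟨b, hab⟩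

theorem onLine_ray_mk_affineChart (he : ‖e‖ = 1) {x : (ℂ ∙ e)ᗮ} (hx : (x : H) ≠ 0) :
    OnLine (ray e he) (Projectivization.mk ℂ (x : H) hx) (affineChart he x) :=
  onLine_mk_iff.mpr ⟨1, 1, by rw [one_smul, one_smul]⟩

end AffineCharts

section Wigner

variable {H K : Type*} [NormedAddCommGroup H] [InnerProductSpace ℂ H] [NormedAddCommGroup K]
  [InnerProductSpace ℂ K] {φ : ℙ ℂ H → ℙ ℂ K} {e : H} {f : K} {he : ‖e‖ = 1} {hf : ‖f‖ = 1}
  {V : (ℂ ∙ e)ᗮ → (ℂ ∙ f)ᗮ}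

theorem exists_affineChart_map_eq (hφ : ∀ p q, overlap (φ p) (φ q) = overlap p q)
    (hef : φ (ray e he) = ray f hf) :
    ∃ V : (ℂ ∙ e)ᗮ → (ℂ ∙ f)ᗮ, ∀ x, affineChart hf (V x) = φ (affineChart he x) := by
  refine Classical.skolem.mp fun x => exists_affineChart_eq hf ?_
  rw [← hef, hφ, overlap_ray_affineChart]
  exact inv_ne_zero (norm_ne_zero_iff.mpr (add_ne_zero_of_mem_orthogonal he x))

theorem norm_add_eq_of_affineChart_eq (hφ : ∀ p q, overlap (φ p) (φ q) = overlap p q)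
    (hef : φ (ray e he) = ray f hf) (hV : ∀ x, affineChart hf (V x) = φ (affineChart he x))
    (x : (ℂ ∙ e)ᗮ) : ‖f + V x‖ = ‖e + x‖ := by
  rw [← inv_inj, ← overlap_ray_affineChart hf, ← overlap_ray_affineChart he, hV, ← hef, hφ]

theorem norm_eq_of_affineChart_eq (hφ : ∀ p q, overlap (φ p) (φ q) = overlap p q)
    (hef : φ (ray e he) = ray f hf) (hV : ∀ x, affineChart hf (V x) = φ (affineChart he x))
    (x : (ℂ ∙ e)ᗮ) : ‖V x‖ = ‖x‖ := by
  have h := congrArg (· ^ 2) (norm_add_eq_of_affineChart_eq hφ hef hV x)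
  simp only [norm_add_sq_of_mem_orthogonal he, norm_add_sq_of_mem_orthogonal hf,
    add_right_inj] at h
  exact (sq_eq_sq₀ (norm_nonneg _) (norm_nonneg _)).mp h

theorem map_mk_eq_of_affineChart_eq (hφ : ∀ p q, overlap (φ p) (φ q) = overlap p q)
    (hef : φ (ray e he) = ray f hf) (hV : ∀ x, affineChart hf (V x) = φ (affineChart he x))
    {x : (ℂ ∙ e)ᗮ} (hx : (x : H) ≠ 0) (hVx : (V x : K) ≠ 0) :
    φ (Projectivization.mk ℂ (x : H) hx) = Projectivization.mk ℂ (V x : K) hVx := by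
  have hortho : overlap (ray e he) (Projectivization.mk ℂ (x : H) hx) = 0 :=
    overlap_mk_eq_zero_iff.mpr (Submodule.mem_orthogonal_singleton_iff_inner_right.mp x.2)
  have hortho' := (hφ _ _).trans hortho
  have hline := onLine_ray_mk_affineChart he hx
  rw [onLine_iff_overlap_sq_add_overlap_sq hortho, ← hφ, ← hφ (Projectivization.mk ℂ _ _),
    ← onLine_iff_overlap_sq_add_overlap_sq hortho', hef, ← hV] at hline
  rw [hef] at hortho'
  exact (mk_eq_of_onLine_affineChart hf hVx hortho' hline).symm

theorem norm_inner_eq_of_affineChart_eq (hφ : ∀ p q, overlap (φ p) (φ q) = overlap p q)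
    (hef : φ (ray e he) = ray f hf) (hV : ∀ x, affineChart hf (V x) = φ (affineChart he x))
    (x y : (ℂ ∙ e)ᗮ) : ‖inner ℂ (V x) (V y)‖ = ‖inner ℂ x y‖ := by
  have hnorm := norm_eq_of_affineChart_eq hφ hef hV
  rcases eq_or_ne x 0 with rfl | hx
  · rw [norm_eq_zero.mp ((hnorm 0).trans norm_zero), inner_zero_left, inner_zero_left]
  rcases eq_or_ne y 0 with rfl | hy
  · rw [norm_eq_zero.mp ((hnorm 0).trans norm_zero), inner_zero_right, inner_zero_right]
  have hV₀ {z : (ℂ ∙ e)ᗮ} (hz : z ≠ 0) : (V z : K) ≠ 0 := by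
    rwa [Ne, Submodule.coe_eq_zero, ← norm_eq_zero, hnorm, norm_eq_zero]
  have hx₀ : (x : H) ≠ 0 := mt Submodule.coe_eq_zero.mp hx
  have hy₀ : (y : H) ≠ 0 := mt Submodule.coe_eq_zero.mp hy
  have h := hφ (Projectivization.mk ℂ (x : H) hx₀) (Projectivization.mk ℂ (y : H) hy₀)
  rw [map_mk_eq_of_affineChart_eq hφ hef hV hx₀ (hV₀ hx),
    map_mk_eq_of_affineChart_eq hφ hef hV hy₀ (hV₀ hy), overlap_mk, overlap_mk,
    ← Submodule.coe_norm, ← Submodule.coe_norm, hnorm, hnorm] at h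
  exact (div_left_inj' (by positivity)).mp h

theorem re_inner_eq_of_affineChart_eq (hφ : ∀ p q, overlap (φ p) (φ q) = overlap p q)
    (hef : φ (ray e he) = ray f hf) (hV : ∀ x, affineChart hf (V x) = φ (affineChart he x))
    (x y : (ℂ ∙ e)ᗮ) : (inner ℂ (V x) (V y)).re = (inner ℂ x y).re := by
  have hnorm : ‖1 + inner ℂ (V x) (V y)‖ = ‖1 + inner ℂ x y‖ := by
    have h := hφ (affineChart he x) (affineChart he y)
    have hne := add_ne_zero_of_mem_orthogonal he
    rw [← hV, ← hV, overlap_affineChart, overlap_affineChart,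
      norm_add_eq_of_affineChart_eq hφ hef hV, norm_add_eq_of_affineChart_eq hφ hef hV] at h
    exact (div_left_inj' (mul_ne_zero (norm_ne_zero_iff.mpr (hne x))
      (norm_ne_zero_iff.mpr (hne y)))).mp h
  have h := congrArg (· ^ 2) (norm_inner_eq_of_affineChart_eq hφ hef hV x y)
  replace hnorm := congrArg (· ^ 2) hnorm
  simp only [Complex.sq_norm, Complex.normSq_apply, Complex.add_re, Complex.add_im,
    Complex.one_re, Complex.one_im, zero_add] at h hnorm
  linarith

theorem exists_linearIsometry_extension {σ : ℂ →+* ℂ} [RingHomIsometric σ] (he : ‖e‖ = 1)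
    (hf : ‖f‖ = 1) (U₀ : (ℂ ∙ e)ᗮ →ₛₗᵢ[σ] (ℂ ∙ f)ᗮ) :
    ∃ U : H →ₛₗᵢ[σ] K, U e = f ∧ ∀ x : (ℂ ∙ e)ᗮ, U x = U₀ x := by
  set P := (ℂ ∙ e)ᗮ.orthogonalProjectionOnto
  have hP (v : H) : inner ℂ e v • e + P v = v := by
    rw [← Submodule.starProjection_unit_singleton ℂ he]
    exact Submodule.starProjection_add_starProjection_orthogonal v
  let T : H →ₛₗ[σ] K :=
    { toFun := fun v => σ (inner ℂ e v) • f + U₀ (P v)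
      map_add' := fun v w => by
        simp only [inner_add_right, map_add, Submodule.coe_add, add_smul]
        abel
      map_smul' := fun t v => by
        simp only [inner_smul_right, map_mul, map_smulₛₗ, RingHom.id_apply,
          Submodule.coe_smul, mul_smul, smul_add] }
  have hT (v : H) : ‖T v‖ = ‖v‖ := by
    rw [← sq_eq_sq₀ (norm_nonneg _) (norm_nonneg _)]
    calc ‖T v‖ ^ 2 = ‖inner ℂ e v‖ ^ 2 + ‖P v‖ ^ 2 := by
          rw [← U₀.norm_map, ← RingHomIsometric.norm_map (σ := σ)]
          exact norm_smul_add_sq_of_mem_orthogonal hf _ _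
      _ = ‖v‖ ^ 2 := by rw [← norm_smul_add_sq_of_mem_orthogonal he, hP]
  refine ⟨⟨T, hT⟩, ?_, fun x => ?_⟩
  · have hPe : P e = 0 := by
      simpa [he] using hP e
    change σ (inner ℂ e e) • f + U₀ (P e) = f
    rw [hPe, inner_self_eq_one_of_norm_eq_one he, map_one, one_smul, map_zero,
      Submodule.coe_zero, add_zero]
  · have hex := Submodule.mem_orthogonal_singleton_iff_inner_right.mp x.2
    have hPx : P x = x := Submodule.orthogonalProjectionOnto_mem_subspace_eq_self x
    change σ (inner ℂ e (x : H)) • f + U₀ (P x) = U₀ x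
    rw [hPx, hex, map_zero, zero_smul, zero_add]

theorem exists_eq_map_of_affineChart {σ : ℂ →+* ℂ} [RingHomIsometric σ]
    (hφ : ∀ p q, overlap (φ p) (φ q) = overlap p q) (hef : φ (ray e he) = ray f hf)
    (U₀ : (ℂ ∙ e)ᗮ →ₛₗᵢ[σ] (ℂ ∙ f)ᗮ)
    (hU₀ : ∀ x, affineChart hf (U₀ x) = φ (affineChart he x)) :
    ∃ U : H →ₛₗᵢ[σ] K, φ = Projectivization.map U.toLinearMap U.injective := by
  obtain ⟨U, hUe, hU⟩ := exists_linearIsometry_extension he hf U₀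
  refine ⟨U, funext fun p => ?_⟩
  by_cases hp : overlap (ray e he) p = 0
  · induction p with | h v hv =>
    have hv' : v ∈ (ℂ ∙ e)ᗮ :=
      Submodule.mem_orthogonal_singleton_iff_inner_right.mpr (overlap_mk_eq_zero_iff.mp hp)
    have hU₀v : (U₀ ⟨v, hv'⟩ : K) ≠ 0 := by
      rw [← hU]
      exact (map_ne_zero_iff U U.injective).mpr hv
    rw [map_mk_eq_of_affineChart_eq hφ hef hU₀ (x := ⟨v, hv'⟩) hv hU₀v, Projectivization.map_mk]
    simp only [← hU, LinearIsometry.coe_toLinearMap]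
  · obtain ⟨x, rfl⟩ := exists_affineChart_eq he hp
    rw [← hU₀, affineChart, affineChart, Projectivization.map_mk]
    simp only [LinearIsometry.coe_toLinearMap, map_add, hUe, hU]

theorem exists_eq_map_of_overlap_map_eq [Nontrivial H]
    (hφ : ∀ p q, overlap (φ p) (φ q) = overlap p q) :
    (∃ U : H →ₗᵢ[ℂ] K, φ = Projectivization.map U.toLinearMap U.injective) ∨
      ∃ U : H →ₛₗᵢ[starRingEnd ℂ] K, φ = Projectivization.map U.toLinearMap U.injective := by
  obtain ⟨e, he⟩ := exists_norm_eq H zero_le_one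
  obtain ⟨f, hf, hef⟩ := exists_ray (φ (ray e he))
  obtain ⟨V, hV⟩ := exists_affineChart_map_eq hφ hef.symm
  rcases exists_linearIsometry_eq_or_exists_conjLinearIsometry_eq
    (re_inner_eq_of_affineChart_eq hφ hef.symm hV)
    (norm_inner_eq_of_affineChart_eq hφ hef.symm hV) with ⟨U₀, rfl⟩ | ⟨U₀, rfl⟩
  · exact Or.inl (exists_eq_map_of_affineChart hφ hef.symm U₀ hV)
  · exact Or.inr (exists_eq_map_of_affineChart hφ hef.symm U₀ hV)

theorem surjective_of_surjective_projectivization_map {σ : ℂ →+* ℂ} [RingHomSurjective σ]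
    (U : H →ₛₗᵢ[σ] K)
    (h : Function.Surjective (Projectivization.map U.toLinearMap U.injective)) :
    Function.Surjective U := by
  intro w
  rcases eq_or_ne w 0 with rfl | hw
  · exact ⟨0, map_zero U⟩
  obtain ⟨p, hp⟩ := h (Projectivization.mk ℂ w hw)
  induction p with | h v hv =>
  rw [Projectivization.map_mk, eq_comm, Projectivization.mk_eq_mk_iff'] at hp
  obtain ⟨a, ha⟩ := hp
  obtain ⟨b, rfl⟩ := RingHom.surjective σ a
  exact ⟨b • v, by rw [← ha, map_smulₛₗ, LinearIsometry.coe_toLinearMap]⟩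

theorem isWignerSymmetry_of_overlap_map_eq [Nontrivial H] {φ : ℙ ℂ H → ℙ ℂ H}
    (hsurj : Function.Surjective φ) (hφ : ∀ p q, overlap (φ p) (φ q) = overlap p q) :
    IsWignerSymmetry φ := by
  rcases exists_eq_map_of_overlap_map_eq hφ with ⟨U, rfl⟩ | ⟨U, rfl⟩
  · exact Or.inl ⟨.ofSurjective U (surjective_of_surjective_projectivization_map U hsurj),
      fun _ _ => rfl⟩
  · exact Or.inr ⟨.ofSurjective U (surjective_of_surjective_projectivization_map U hsurj),
      fun _ _ => rfl⟩

end Wigner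

theorem mainTheorem1_general {H : Type*} [NormedAddCommGroup H] [InnerProductSpace ℂ H]
    (hdim : 3 ≤ Module.rank ℂ H) (α : ℝ) (hα₁ : Real.pi / 4 < α) (hα₂ : α < Real.pi / 2)
    (φ : ℙ ℂ H → ℙ ℂ H) (hφ : Function.Bijective φ)
    (hpres : ∀ p q : ℙ ℂ H, quantumAngle p q = α ↔ quantumAngle (φ p) (φ q) = α) :
    IsWignerSymmetry φ := by
  have hpos : 0 < Real.cos α := Real.cos_pos_of_mem_Ioo ⟨by linarith, hα₂⟩
  have hlt : 2 * Real.cos α ^ 2 < 1 := by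
    have h : Real.cos (2 * α) < 0 :=
      Real.cos_neg_of_pi_div_two_lt_of_lt (by linarith) (by linarith)
    rw [Real.cos_two_mul] at h
    linarith
  have hpreserves : PreservesOverlap (Real.cos α) (Equiv.ofBijective φ hφ) := fun p q => by
    rw [← quantumAngle_eq_iff (by linarith) (by linarith),
      ← quantumAngle_eq_iff (by linarith) (by linarith)]
    exact hpres p q
  have : Nontrivial H := rank_pos_iff_nontrivial.mp (zero_lt_three.trans_le hdim)
  exact isWignerSymmetry_of_overlap_map_eq hφ.surjective
    (hpreserves.overlap_map hpos hlt hdim)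

theorem mainTheorem1 {H : Type*} [NormedAddCommGroup H] [InnerProductSpace ℂ H] [CompleteSpace H]
    (hdim : 3 ≤ Module.rank ℂ H) (α : ℝ) (hα₁ : Real.pi / 4 < α) (hα₂ : α < Real.pi / 2)
    (φ : ℙ ℂ H → ℙ ℂ H) (hφ : Function.Bijective φ)
    (hpres : ∀ p q : ℙ ℂ H, quantumAngle p q = α ↔ quantumAngle (φ p) (φ q) = α) :
    IsWignerSymmetry φ :=
  mainTheorem1_general hdim α hα₁ hα₂ φ hφ hpres
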